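/- \textbf{Setting.} Let $1\le n<d$, let $X,X_1,\dots,X_n$ be i.i.d. covariates in $\mathbb{R}^p$ and $\mathbf a:\mathbb{R}^p\to\mathbb{R}^d$ a measurable feature map that is whitened, $\mathbb{E}[\mathbf a(X)\mathbf a(X)^\top]=I_d$. Let $W,W_1,\dots,W_n\sim\mathcal N(0,\sigma^2)$, $\sigma>0$, be i.i.d. and independent of the covariates, let $\mathbf A\in\mathbb{R}^{n\times d}$ have rows $\mathbf a(X_i)^\top$ and columns $\mathbf a_1,\dots,\mathbf a_d$, and let $\mathbf Y=\mathbf A\alpha^*+(W_1,\dots,W_n)^\top$ for a fixed $\alpha^*\in\mathbb{R}^d$. The $(k,\sigma)$-sparse linear model requires that $\alpha^*$ has at most $k$ nonzero entries. The test MSE of $\hat\alpha\in\mathbb{R}^d$ is $\mathcal E_{\mathsf{test}}(\hat\alpha)=\mathbb{E}\big[(\langle \mathbf a(X),\alpha^*\rangle+W-\langle\mathbf a(X),\hat\alpha\rangle)^2\big]-\sigma^2$, the expectation being over a fresh pair $(X,W)$ only. A real random variable $Z$ is sub-Gaussian with parameter at most $K$ if $q^{-1/2}(\mathbb{E}|Z|^q)^{1/q}\le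 K$ for all real $q\ge1$; a random vector $\mathbf a(X)$ is so if $\langle\mathbf a(X),v\rangle/\|v\|_2$ is, for every $v\ne0$. \textbf{OMP run to completion} on $(\mathbf A,\mathbf Y)$: start with $S=\emptyset$; while the residual $\mathbf r=(I-P_S)\mathbf Y$ is nonzero, where $P_S$ is the orthogonal projection onto $\mathrm{span}\{\mathbf a_j:j\in S\}$, add to $S$ an index maximizing $|\langle\mathbf a_j,\mathbf r\rangle|$ (ties are broken arbitrarily); when the residual is zero, return the least squares fit $\hat\alpha_{\mathsf{OMP}}$ of $\mathbf Y$ supported on $S$. A map $\hat\alpha:\mathbb{R}^n\to\mathbb{R}^d$ is a $\beta$-parsimonious interpolating operator for a matrix $A\in\mathbb{R}^{n\times d}$ if for all $y\in\mathbb{R}^n$ we have $A\hat\alpha(y)=y$ and $\|A\,\hat\alpha(y)_{\mathsf{trunc}}\|_2^2\ge\beta\|y\|_2^2$, where $\hat\alpha(y)_{\mathsf{trunc}}$ keeps the $n$ entries of $\hat\alpha(y)$ of largest absolute value and sets the others to zero. \textbf{Statement.} \begin{enumerate} \item Let $A\in\mathbb{R}^{n\times d}$ have rank $n$. For every $y\in\mathbb{R}^n$,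 each iteration of OMP on $(A,y)$ selects a new feature, there are at most $n$ iterations, and OMP runs to completion. The operator $y\mapsto\hat\alpha_{\mathsf{OMP}}(y)$ is $1$-parsimonious. \item Let $K>0$. There is a constant $C>0$ depending only on $K$ such that the following holds for all $n,d,p$ and all whitened features as above such that either the entries of $\mathbf a(X)$ are i.i.d. $\mathcal N(0,1)$, or $\mathbf a(X)$ is sub-Gaussian with parameter at most $K$. \begin{enumerate} \item For every $\sigma>0$ and every $\alpha^*$, almost surely, every completed run of OMP on $(\mathbf A,\mathbf Y)$ selects exactly $n$ features, and its output has exactly $n$ nonzero entries. \item For every $k\ge0$ and $\sigma>0$ there is an instance $\alpha^*$ of the $(k,\sigma)$-sparse linear model such that, for every $\delta>0$, with probability at least $1-e^{-n\ln(d/n)}-e^{-n\delta^2/2}$ over the features and the noise, every output $\hat\alpha_{\mathsf{OMP}}$ of OMP run to completion on $(\mathbf A,\mathbf Y)$ satisfies $$\mathcal E_{\mathsf{test}}(\hat\alpha_{\mathsf{OMP}})\ \ge\ \frac{\sigma^2(1-\delta)}{C\ln(d/n)} .$$ \end{enumerate} \end{enumerate} (Completed runs exist whenever $\mathbf A$ has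 rank $n$, by part 1.) -/

import Mathlib

open MeasureTheory ProbabilityTheory

noncomputable section

namespace OMP

/-! ## Linear algebra of a design matrix -/

/-- Euclidean space `ℝ^m`. -/
abbrev E (m : ℕ) : Type := EuclideanSpace ℝ (Fin m)

/-- The vector `A α ∈ ℝ^n`. -/
def apply {n d : ℕ} (A : Matrix (Fin n) (Fin d) ℝ) (α : E d) : E n :=
  WithLp.toLp 2 (A.mulVec α.ofLp)

/-- The `j`-th column `a_j ∈ ℝ^n` of `A`. -/
def column {n d : ℕ} (A : Matrix (Fin n) (Fin d) ℝ) (j : Fin d) : E n :=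
  WithLp.toLp 2 (fun i => A i j)

/-- The support of a coefficient vector. -/
def support {d : ℕ} (α : E d) : Finset (Fin d) :=
  Finset.univ.filter (fun j => α j ≠ 0)

/-! ## Orthogonal matching pursuit -/

/-- The residual `y - P_S y`, where `P_S` is the orthogonal projection onto the span of the
columns selected in `S`. -/
def residual {n d : ℕ} (A : Matrix (Fin n) (Fin d) ℝ) (y : E n) (S : Finset (Fin d)) : E n :=
  y - (Submodule.span ℝ (column A '' (S : Set (Fin d)))).starProjection y

/-- `OMPReaches A y t S`: on the output `y`, orthogonal matching pursuit can have selected exactly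
the set `S` after `t` iterations. As long as the residual is not zero, an iteration adds to `S`
a column whose inner product with the current residual is largest in absolute value; ties may be
broken in any way. -/
inductive OMPReaches {n d : ℕ} (A : Matrix (Fin n) (Fin d) ℝ) (y : E n) :
    ℕ → Finset (Fin d) → Prop
  | start : OMPReaches A y 0 ∅
  | step {t : ℕ} {S : Finset (Fin d)} {s : Fin d} :
      OMPReaches A y t S →
      residual A y S ≠ 0 →
      (∀ j : Fin d, |inner ℝ (column A j) (residual A y S)| ≤
        |inner ℝ (column A s) (residual A y S)|) →
      OMPReaches A y (t + 1) (insert s S)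

/-- `α` is an ordinary least squares fit of `y` that uses only the columns in `S`. -/
def IsOLS {n d : ℕ} (A : Matrix (Fin n) (Fin d) ℝ) (y : E n) (S : Finset (Fin d)) (α : E d) :
    Prop :=
  support α ⊆ S ∧ ∀ α' : E d, support α' ⊆ S → ‖y - apply A α‖ ≤ ‖y - apply A α'‖

/-- `α` is the output of orthogonal matching pursuit run to completion (until the residual
vanishes) on the data `(A, y)`, and `S` is the set of features that it has selected. -/
def IsOMPOutput {n d : ℕ} (A : Matrix (Fin n) (Fin d) ℝ) (y : E n) (S : Finset (Fin d)) (α : E d) :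
    Prop :=
  (∃ t : ℕ, OMPReaches A y t S) ∧ residual A y S = 0 ∧ IsOLS A y S α

/-! ## Parsimonious interpolating operators -/

/-- `S` is a set of indices of the top `m` absolute values of the coefficients of `α`. -/
def IsTop {d : ℕ} (m : ℕ) (α : E d) (S : Finset (Fin d)) : Prop :=
  S.card = m ∧ ∀ i ∈ S, ∀ j ∉ S, |α j| ≤ |α i|

/-- The truncation of `α` to the coordinates in `S`. -/
def truncate {d : ℕ} (S : Finset (Fin d)) (α : E d) : E d :=
  WithLp.toLp 2 (fun j => if j ∈ S then α j else 0)

/-- `f` is a `β`-parsimonious interpolating operator for the design matrix `A` with `n` rows: it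
interpolates every `y`, and the top `n` coefficients of `f y` capture at least the fraction `β` of
the energy of `y`. -/
def IsParsimonious {n d : ℕ} (A : Matrix (Fin n) (Fin d) ℝ) (β : ℝ) (f : E n → E d) : Prop :=
  (∀ y, apply A (f y) = y) ∧
    ∀ y S, IsTop n (f y) S → β * ‖y‖ ^ 2 ≤ ‖apply A (truncate S (f y))‖ ^ 2

/-! ## Random features

`ν` is the distribution of the covariate in `ℝ^p`, and `a : ℝ^p → ℝ^d` is the feature map. -/

/-- The features are whitened: `𝔼[a(X) a(X)ᵀ] = I`. -/
def IsWhitened {p d : ℕ} (ν : Measure (E p)) (a : E p → E d) : Prop :=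
  ∀ i j : Fin d, ∫ x, a x i * a x j ∂ν = if i = j then 1 else 0

/-- The entries of the feature vector are i.i.d. standard Gaussian. -/
def IsGaussianFeature {p d : ℕ} (ν : Measure (E p)) (a : E p → E d) : Prop :=
  iIndepFun (fun (j : Fin d) (x : E p) => a x j) ν ∧
    ∀ j : Fin d, ν.map (fun x => a x j) = gaussianReal 0 1

/-- The real random variable `Z` is sub-Gaussian with parameter at most `K`:
`p ^ (-1/2) * 𝔼[|Z| ^ p] ^ (1/p) ≤ K` for all real `p ≥ 1`. -/
def IsSubGaussianVar {Ω : Type*} [MeasurableSpace Ω] (P : Measure Ω) (K : ℝ) (Z : Ω → ℝ) : Prop :=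
  ∀ p : ℝ, 1 ≤ p → eLpNorm Z (ENNReal.ofReal p) P ≤ ENNReal.ofReal (K * √p)

/-- The feature vector is sub-Gaussian with parameter at most `K`: so is `⟨a(X), v⟩ / ‖v‖` for
every fixed nonzero `v`. -/
def IsSubGaussianFeature {p d : ℕ} (ν : Measure (E p)) (K : ℝ) (a : E p → E d) : Prop :=
  ∀ v : E d, v ≠ 0 → IsSubGaussianVar ν K (fun x => inner ℝ (a x) v / ‖v‖)

/-! ## The noisy linear model -/

/-- The distribution `N(0, σ²)` of one noise variable. -/
def noiseLaw (σ : ℝ) : Measure ℝ := gaussianReal 0 (σ ^ 2).toNNReal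

/-- The joint distribution of the training covariates `(X_1, …, X_n)`, i.i.d. with law `ν`, and the
training noise `(W_1, …, W_n)`, i.i.d. `N(0, σ²)` and independent of the covariates. -/
def trainLaw {p : ℕ} (n : ℕ) (ν : Measure (E p)) (σ : ℝ) :
    Measure ((Fin n → E p) × (Fin n → ℝ)) :=
  (Measure.pi fun _ => ν).prod (Measure.pi fun _ => noiseLaw σ)

/-- The training feature matrix, with rows `a(x_1), …, a(x_n)`. -/
def trainMatrix {p d n : ℕ} (a : E p → E d) (x : Fin n → E p) : Matrix (Fin n) (Fin d) ℝ :=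
  Matrix.of fun i j => a (x i) j

/-- The training output vector, `y_i = ⟨a(x_i), α⟩ + w_i`. -/
def trainOutput {p d n : ℕ} (a : E p → E d) (αstar : E d) (x : Fin n → E p) (w : Fin n → ℝ) : E n :=
  WithLp.toLp 2 fun i => inner ℝ (a (x i)) αstar + w i

/-- The test mean squared error of the coefficient vector `α`, minus the irreducible error:
`𝔼[(Y - ⟨a(X), α⟩)²] - σ²`, where `Y = ⟨a(X), αstar⟩ + W`, over a fresh test sample `(X, W)`. -/
def testMSE {p d : ℕ} (ν : Measure (E p)) (σ : ℝ) (a : E p → E d) (αstar α : E d) : ℝ :=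
  (∫ z, ((inner ℝ (a z.1) αstar + z.2) - inner ℝ (a z.1) α) ^ 2 ∂(ν.prod (noiseLaw σ))) - σ ^ 2

end OMP

end

/-! Part 1 is orthogonality. The residual is orthogonal to the selected columns, while full row rank
makes some column correlate with it, so each maximizer lies outside the span selected so far. Hence
the selected columns stay independent, there are at most `n` of them, and truncation to `n` entries
loses nothing. For part 2(a), given the features, fewer than `n` columns span a proper subspace,
which Gaussian noise avoids almost surely.

For part 2(b) the instance is `αstar = 0`. Whitening turns the test error into `‖α‖ ^ 2`, and the
output solves `A α = w` with pure noise `w` and exactly `n` nonzero entries. It remains to show that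
such an `α` is not small; write `L = log (d / n)`.

If `d ≥ 2n`, sparsity is used: a union bound over supports shows that `‖A α‖ ^ 2 ≲ n L ‖α‖ ^ 2` for
all `n`-sparse `α` (`pi_exists_sparse_lt_norm_sq_apply_le`), while `‖w‖ ^ 2 ≳ σ ^ 2 n`
(`pi_noiseLaw_norm_sq_le`).

If `d = n + m` with `m ≤ n`, then `L` is of order `m / n`, and a bound of order `n L` is out of
reach, since a single column already has mean squared norm `n`. Instead every interpolant is shown
to be large, sparse or not (`trainLaw_exists_interpolant_le`). The least squared norm is `wᵀ G⁻¹ w`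
with `G = A Aᵀ`, and its Laplace transform over the noise is `√(det G / det (G + τ I))`. Bounding
`det (G + τ I)` below by principal minors reduces the mean of this ratio to means of `det G / det
G_T`. Those need only whitening: a fresh row has expected squared distance `d - |T|` to the span of
independent rows indexed by `T`. -/

namespace OMP

/-! ## Deterministic properties of orthogonal matching pursuit -/

section Deterministic

variable {n d : ℕ} {A : Matrix (Fin n) (Fin d) ℝ} {y : E n} {S : Finset (Fin d)} {α : E d}

theorem mem_support {α : E d} {j : Fin d} : j ∈ support α ↔ α j ≠ 0 := by
  simp [support]

theorem apply_eq_sum (A : Matrix (Fin n) (Fin d) ℝ) (α : E d) :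
    apply A α = ∑ j, α j • column A j := by
  ext i
  simp [apply, column, Matrix.mulVec, dotProduct, mul_comm]

theorem apply_mem_span (h : support α ⊆ S) :
    apply A α ∈ Submodule.span ℝ (column A '' (S : Set (Fin d))) := by
  rw [apply_eq_sum]
  refine Submodule.sum_mem _ fun j _ => ?_
  by_cases hj : α j = 0
  · simp [hj]
  · exact Submodule.smul_mem _ _ (Submodule.subset_span
      ⟨j, Finset.mem_coe.2 (h (mem_support.2 hj)), rfl⟩)

theorem exists_apply_eq_of_mem_span
    (hy : y ∈ Submodule.span ℝ (column A '' (S : Set (Fin d)))) :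
    ∃ α : E d, support α ⊆ S ∧ apply A α = y := by
  classical
  obtain ⟨c, hc⟩ := (Submodule.mem_span_image_finset_iff_exists_fun ℝ).1 hy
  refine ⟨WithLp.toLp 2 fun j => if h : j ∈ S then c ⟨j, h⟩ else 0, fun j hj => ?_, ?_⟩
  · by_contra hjS
    exact mem_support.1 hj (by simp [hjS])
  · rw [apply_eq_sum, ← hc, ← Finset.sum_subset (Finset.subset_univ S), ← Finset.sum_coe_sort S]
    · exact Finset.sum_congr rfl fun i _ => by simp
    · intro j _ hj
      simp [hj]

theorem residual_eq_zero_iff :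
    residual A y S = 0 ↔ y ∈ Submodule.span ℝ (column A '' (S : Set (Fin d))) := by
  rw [residual, sub_eq_zero, eq_comm, Submodule.starProjection_eq_self_iff]

theorem inner_residual_eq_zero {v : E n}
    (hv : v ∈ Submodule.span ℝ (column A '' (S : Set (Fin d)))) :
    inner ℝ v (residual A y S) = 0 :=
  (Submodule.mem_orthogonal _ _).1 (Submodule.sub_starProjection_mem_orthogonal y) v hv

/-- The output of a completed run interpolates the data. -/
theorem IsOMPOutput.apply_eq (h : IsOMPOutput A y S α) : apply A α = y := by
  obtain ⟨α', hα', hy⟩ := exists_apply_eq_of_mem_span (residual_eq_zero_iff.1 h.2.1)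
  have := h.2.2.2 α' hα'
  rw [hy, sub_self, norm_zero] at this
  exact (sub_eq_zero.1 (norm_le_zero_iff.1 this)).symm

theorem rank_eq_finrank_span_column (A : Matrix (Fin n) (Fin d) ℝ) :
    A.rank = Module.finrank ℝ (Submodule.span ℝ (Set.range (column A))) := by
  have h : Set.range (column A) = (WithLp.linearEquiv 2 ℝ (Fin n → ℝ)).symm '' Set.range A.col := by
    rw [← Set.range_comp]
    rfl
  rw [h, ← LinearEquiv.coe_coe, Submodule.span_image, LinearEquiv.finrank_map_eq,
    Matrix.rank_eq_finrank_span_cols]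

theorem span_column_eq_top (hA : A.rank = n) :
    Submodule.span ℝ (Set.range (column A)) = ⊤ := by
  apply Submodule.eq_top_of_finrank_eq
  rw [← rank_eq_finrank_span_column, hA]
  simp

/-- As long as the residual is not zero, a column of a matrix of full row rank correlates with
it. -/
theorem exists_inner_column_ne_zero (hA : A.rank = n) {r : E n} (hr : r ≠ 0) :
    ∃ j, inner ℝ (column A j) r ≠ 0 := by
  by_contra! h
  have : r ∈ (Submodule.span ℝ (Set.range (column A)))ᗮ := by
    rw [Submodule.mem_orthogonal]
    intro u hu
    induction hu using Submodule.span_induction with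
    | mem x hx => obtain ⟨j, rfl⟩ := hx; exact h j
    | zero => simp
    | add x y _ _ hx hy => rw [inner_add_left, hx, hy, add_zero]
    | smul c x _ hx => rw [inner_smul_left, hx, mul_zero]
  rw [span_column_eq_top hA, Submodule.top_orthogonal_eq_bot] at this
  exact hr ((Submodule.mem_bot ℝ).1 this)

/-- The maximizing column has nonzero inner product with the residual, whereas everything in the
span of the selected columns is orthogonal to it; so the new column leaves that span. -/
theorem OMPReaches.card_eq_and_linearIndepOn (hA : A.rank = n) {t : ℕ}
    (h : OMPReaches A y t S) : S.card = t ∧ LinearIndepOn ℝ (column A) (S : Set (Fin d)) := by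
  induction h with
  | start => simp
  | @step t S s _ hr hmax ih =>
    obtain ⟨j, hj⟩ := exists_inner_column_ne_zero hA hr
    have hs : inner ℝ (column A s) (residual A y S) ≠ 0 :=
      abs_pos.1 ((abs_pos.2 hj).trans_le (hmax j))
    have hspan : column A s ∉ Submodule.span ℝ (column A '' (S : Set (Fin d))) :=
      fun hmem => hs (inner_residual_eq_zero hmem)
    have hsS : s ∉ S := fun hmem => hspan (Submodule.subset_span ⟨s, hmem, rfl⟩)
    refine ⟨by rw [Finset.card_insert_of_notMem hsS, ih.1], ?_⟩
    rw [Finset.coe_insert]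
    exact ih.2.insert hspan

theorem OMPReaches.card_le (hA : A.rank = n) {t : ℕ} (h : OMPReaches A y t S) :
    S.card = t ∧ t ≤ n := by
  obtain ⟨h1, h2⟩ := h.card_eq_and_linearIndepOn hA
  refine ⟨h1, ?_⟩
  have := LinearIndependent.fintype_card_le_finrank (R := ℝ) h2
  simpa [h1] using this

/-- A residual that never vanished would allow `n + 1` iterations, one more than independence
permits. -/
theorem exists_isOMPOutput (hA : A.rank = n) (y : E n) :
    ∃ (S : Finset (Fin d)) (α : E d), IsOMPOutput A y S α := by
  have key : ∃ (t : ℕ) (S : Finset (Fin d)), OMPReaches A y t S ∧ residual A y S = 0 := by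
    by_contra! hne
    have hall : ∀ t, ∃ S, OMPReaches A y t S := by
      intro t
      induction t with
      | zero => exact ⟨∅, .start⟩
      | succ t ih =>
        obtain ⟨S, hS⟩ := ih
        have hr := hne t S hS
        obtain ⟨j, -⟩ := exists_inner_column_ne_zero hA hr
        obtain ⟨s, -, hs⟩ := Finset.exists_max_image Finset.univ
          (fun j => |inner ℝ (column A j) (residual A y S)|) ⟨j, Finset.mem_univ j⟩
        exact ⟨insert s S, .step hS hr fun j => hs j (Finset.mem_univ j)⟩
    obtain ⟨S, hS⟩ := hall (n + 1)
    have := (hS.card_le hA).2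
    omega
  obtain ⟨t, S, hS, hr⟩ := key
  obtain ⟨α, hα, hy⟩ := exists_apply_eq_of_mem_span (residual_eq_zero_iff.1 hr)
  exact ⟨S, α, ⟨t, hS⟩, hr, hα, fun α' _ => by simp [hy]⟩

/-- Truncation to the top `m` coefficients does not change a vector with at most `m` nonzero
coefficients. -/
theorem truncate_eq_self {m : ℕ} {T : Finset (Fin d)} (hα : (support α).card ≤ m)
    (hT : IsTop m α T) : truncate T α = α := by
  have hsub : support α ⊆ T := by
    intro j hj
    by_contra hjT
    -- A nonzero entry left out of a top set forces all `m` entries in the set to be nonzero, giving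
    -- `m + 1` in total.
    have hT' : insert j T ⊆ support α := by
      intro i hi
      rcases Finset.mem_insert.1 hi with rfl | hi
      · exact hj
      · exact mem_support.2 (abs_pos.1 ((abs_pos.2 (mem_support.1 hj)).trans_le (hT.2 i hi j hjT)))
    have := Finset.card_le_card hT'
    rw [Finset.card_insert_of_notMem hjT, hT.1] at this
    omega
  ext j
  by_cases hj : j ∈ T
  · simp [truncate, hj]
  · have : α j = 0 := by
      by_contra h
      exact hj (hsub (mem_support.2 h))
    simp [truncate, hj, this]

theorem isParsimonious_of_isOMPOutput (hA : A.rank = n) {f : E n → E d}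
    (hf : ∀ y, ∃ S : Finset (Fin d), IsOMPOutput A y S (f y)) : IsParsimonious A 1 f := by
  refine ⟨fun y => (hf y).choose_spec.apply_eq, fun y T hT => ?_⟩
  obtain ⟨S, hS⟩ := hf y
  obtain ⟨t, ht⟩ := hS.1
  have hcard : (support (f y)).card ≤ n :=
    (Finset.card_le_card hS.2.2.1).trans ((ht.card_le hA).1 ▸ (ht.card_le hA).2)
  rw [truncate_eq_self hcard hT, hS.apply_eq, one_mul]

end Deterministic

/-! ## Gaussian noise -/

section Gaussian

open scoped Matrix

instance isProbabilityMeasure_noiseLaw (σ : ℝ) : IsProbabilityMeasure (noiseLaw σ) := by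
  unfold noiseLaw
  infer_instance

theorem prod_setLIntegral_ofReal_eq {ι : Type*} [Fintype ι] {f : ℝ → ℝ} (hf : Integrable f)
    (hf0 : ∀ x, 0 ≤ f x) (s : ι → Set ℝ) :
    ∫⁻ w in Set.univ.pi s, ENNReal.ofReal (∏ i, f (w i)) =
      ∏ i, ∫⁻ x in s i, ENNReal.ofReal (f x) := by
  have hint : ∀ i, Integrable f (volume.restrict (s i)) := fun i => hf.restrict
  rw [volume_pi, Measure.restrict_pi_pi, ← ofReal_integral_eq_lintegral_ofReal
    (Integrable.fintype_prod hint) (ae_of_all _ fun w => Finset.prod_nonneg fun i _ => hf0 _),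
    integral_fintype_prod_eq_prod (fun _ => f),
    ENNReal.ofReal_prod_of_nonneg fun i _ => integral_nonneg hf0]
  exact Finset.prod_congr rfl fun i _ =>
    ofReal_integral_eq_lintegral_ofReal (hint i) (ae_of_all _ hf0)

theorem pi_noiseLaw_eq_withDensity (n : ℕ) {σ : ℝ} (hσ : 0 < σ) :
    Measure.pi (fun _ : Fin n => noiseLaw σ) = volume.withDensity fun w : Fin n → ℝ =>
      ENNReal.ofReal (∏ i, gaussianPDFReal 0 (σ ^ 2).toNNReal (w i)) := by
  refine Measure.pi_eq fun s hs => ?_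
  rw [withDensity_apply _ (MeasurableSet.univ_pi hs), prod_setLIntegral_ofReal_eq
    (integrable_gaussianPDFReal _ _) (gaussianPDFReal_nonneg _ _)]
  refine Finset.prod_congr rfl fun i _ => ?_
  rw [noiseLaw, gaussianReal_of_var_ne_zero _ (by simpa using hσ.ne'),
    withDensity_apply _ (hs i)]
  rfl

theorem pi_noiseLaw_absolutelyContinuous (n : ℕ) {σ : ℝ} (hσ : 0 < σ) :
    Measure.pi (fun _ : Fin n => noiseLaw σ) ≪ volume := by
  rw [pi_noiseLaw_eq_withDensity n hσ]
  exact withDensity_absolutelyContinuous _ _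

theorem prod_gaussianPDFReal_eq (n : ℕ) (σ : ℝ) (w : Fin n → ℝ) :
    ∏ i, gaussianPDFReal 0 (σ ^ 2).toNNReal (w i) =
      (√(2 * Real.pi * σ ^ 2))⁻¹ ^ n * Real.exp (-(w ⬝ᵥ w) / (2 * σ ^ 2)) := by
  simp only [gaussianPDFReal, Real.coe_toNNReal _ (sq_nonneg σ), sub_zero]
  rw [Finset.prod_mul_distrib, ← Real.exp_sum, Finset.prod_const, Finset.card_univ,
    Fintype.card_fin, ← Finset.sum_div, Finset.sum_neg_distrib, dotProduct]
  simp only [sq]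

theorem exists_transpose_mul_self_eq {n : ℕ} {Q : Matrix (Fin n) (Fin n) ℝ} (hQ : Q.PosSemidef) :
    ∃ L : Matrix (Fin n) (Fin n) ℝ, Lᵀ * L = Q := by
  open scoped MatrixOrder in
  obtain ⟨L, hL⟩ := CStarAlgebra.nonneg_iff_eq_star_mul_self.1 hQ.nonneg
  exact ⟨L, by rw [hL, Matrix.star_eq_conjTranspose, Matrix.conjTranspose_eq_transpose_of_trivial]⟩

/-- The Laplace transform of a nonnegative quadratic form in Gaussian noise. -/
theorem lintegral_exp_neg_quadratic {n : ℕ} {σ : ℝ} (hσ : 0 < σ) {s : ℝ} (hs : 0 ≤ s)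
    {M : Matrix (Fin n) (Fin n) ℝ} (hM : M.PosSemidef) :
    ∫⁻ w, ENNReal.ofReal (Real.exp (-(s * (w ⬝ᵥ M *ᵥ w))))
        ∂(Measure.pi fun _ : Fin n => noiseLaw σ) =
      ENNReal.ofReal (√(1 + (2 * s * σ ^ 2) • M).det)⁻¹ := by
  have hQ : (1 + (2 * s * σ ^ 2) • M).PosDef :=
    Matrix.PosDef.one.add_posSemidef (hM.smul (by positivity))
  -- With `1 + 2sσ²M = LᵀL`, the tilted Gaussian density at `w` is the original density at `L w`.
  -- The change of variables then leaves only the Jacobian `|det L|⁻¹`.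
  obtain ⟨L, hL⟩ := exists_transpose_mul_self_eq hQ.posSemidef
  have hdet : L.det ^ 2 = (1 + (2 * s * σ ^ 2) • M).det := by
    rw [← hL, Matrix.det_mul, Matrix.det_transpose, sq]
  have hL0 : L.det ≠ 0 := fun h => by
    have := hQ.det_pos
    rw [← hdet, h] at this
    norm_num at this
  set ρ : (Fin n → ℝ) → ENNReal := fun w =>
    ENNReal.ofReal (∏ i, gaussianPDFReal 0 (σ ^ 2).toNNReal (w i)) with hρ
  have hρm : Measurable ρ := by
    refine ENNReal.measurable_ofReal.comp (Finset.measurable_fun_prod _ fun i _ => ?_)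
    exact (measurable_gaussianPDFReal _ _).comp (measurable_pi_apply i)
  have hρ1 : ∫⁻ w, ρ w = 1 := by
    have : (Measure.pi fun _ : Fin n => noiseLaw σ) Set.univ = 1 := measure_univ
    rwa [pi_noiseLaw_eq_withDensity n hσ, withDensity_apply _ MeasurableSet.univ,
      Measure.restrict_univ] at this
  have hchange : ∀ w, ρ w * ENNReal.ofReal (Real.exp (-(s * (w ⬝ᵥ M *ᵥ w)))) =
      ρ (Matrix.toLin' L w) := by
    intro w
    have hquad : (L *ᵥ w) ⬝ᵥ (L *ᵥ w) = w ⬝ᵥ w + 2 * s * σ ^ 2 * (w ⬝ᵥ M *ᵥ w) := by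
      rw [Matrix.dotProduct_mulVec, ← Matrix.mulVec_transpose, Matrix.mulVec_mulVec, hL,
        Matrix.add_mulVec, Matrix.one_mulVec, add_dotProduct, Matrix.smul_mulVec,
        smul_dotProduct, smul_eq_mul, dotProduct_comm (M *ᵥ w)]
    simp only [hρ, prod_gaussianPDFReal_eq n σ, Matrix.toLin'_apply]
    rw [← ENNReal.ofReal_mul (by positivity), mul_assoc, ← Real.exp_add, hquad]
    congr 3
    field_simp
    ring
  rw [pi_noiseLaw_eq_withDensity n hσ, lintegral_withDensity_eq_lintegral_mul _ hρm
    (by fun_prop)]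
  simp only [Pi.mul_apply, hchange]
  rw [← lintegral_map (f := ρ) (g := Matrix.toLin' L) hρm
    (Matrix.toLin' L).continuous_of_finiteDimensional.measurable,
    Real.map_matrix_volume_pi_eq_smul_volume_pi hL0, lintegral_smul_measure, hρ1, smul_eq_mul,
    mul_one, ← hdet, Real.sqrt_sq_eq_abs, abs_inv]

theorem dotProduct_self_eq_norm_sq {m : ℕ} (α : E m) : α.ofLp ⬝ᵥ α.ofLp = ‖α‖ ^ 2 := by
  rw [EuclideanSpace.real_norm_sq_eq]
  simp [dotProduct, sq]

/-- Among the solutions of `A α = w`, none has squared norm below `wᵀ (A Aᵀ)⁻¹ w`. -/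
theorem dotProduct_inv_mulVec_le_norm_sq {n d : ℕ} {A : Matrix (Fin n) (Fin d) ℝ}
    (hA : (A * Aᵀ).det ≠ 0) (α : E d) :
    (A *ᵥ α.ofLp) ⬝ᵥ (A * Aᵀ)⁻¹ *ᵥ (A *ᵥ α.ofLp) ≤ ‖α‖ ^ 2 := by
  obtain ⟨w, hw⟩ : ∃ w, w = A *ᵥ α.ofLp := ⟨_, rfl⟩
  obtain ⟨u, hu⟩ : ∃ u, u = (A * Aᵀ)⁻¹ *ᵥ w := ⟨_, rfl⟩
  have huw : A *ᵥ (Aᵀ *ᵥ u) = w := by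
    rw [hu, Matrix.mulVec_mulVec, Matrix.mulVec_mulVec, Matrix.mul_nonsing_inv _ (Ne.isUnit hA),
      Matrix.one_mulVec]
  have hadj : ∀ x : Fin d → ℝ, (A *ᵥ x) ⬝ᵥ u = x ⬝ᵥ Aᵀ *ᵥ u := fun x => by
    rw [Matrix.dotProduct_mulVec, ← Matrix.mulVec_transpose, Matrix.transpose_transpose]
  -- `z` is the solution of least norm. Since `⟨α, z⟩ = ‖z‖ ^ 2 = w ⬝ᵥ u`, the claim is `0 ≤ ‖α - z‖
  -- ^ 2`.
  set z : E d := WithLp.toLp 2 (Aᵀ *ᵥ u) with hz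
  have h1 : w ⬝ᵥ u = ‖z‖ ^ 2 := by
    rw [← dotProduct_self_eq_norm_sq, ← huw, hadj]
  have h2 : w ⬝ᵥ u = α.ofLp ⬝ᵥ z.ofLp := by
    rw [hw, hadj]
  rw [← hw, ← hu]
  have h3 : 0 ≤ ‖α‖ ^ 2 - 2 * (α.ofLp ⬝ᵥ z.ofLp) + ‖z‖ ^ 2 := by
    have := sq_nonneg ‖α - z‖
    rw [← dotProduct_self_eq_norm_sq] at this
    rw [← dotProduct_self_eq_norm_sq, ← dotProduct_self_eq_norm_sq]
    simp only [WithLp.ofLp_sub, sub_dotProduct, dotProduct_sub] at this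
    rw [dotProduct_comm z.ofLp α.ofLp] at this
    linarith
  rw [← h2, ← h1] at h3
  linarith

/-- If `u A Aᵀ = 0`, then `‖u A‖ ^ 2 = 0`. -/
theorem exists_vecMul_eq_zero_of_det_mul_transpose_eq_zero {ι κ : Type*} [Fintype ι] [DecidableEq ι]
    [Fintype κ] {A : Matrix ι κ ℝ} (hA : (A * Aᵀ).det = 0) : ∃ u ≠ 0, u ᵥ* A = 0 := by
  obtain ⟨u, hu0, hu⟩ := Matrix.exists_vecMul_eq_zero_iff.2 hA
  refine ⟨u, hu0, ?_⟩
  rw [← dotProduct_self_eq_zero, ← Matrix.dotProduct_mulVec, ← Matrix.mulVec_transpose,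
    Matrix.mulVec_mulVec, Matrix.dotProduct_mulVec, hu, zero_dotProduct]

/-- The image of a matrix without full row rank is a null set. -/
theorem pi_noiseLaw_range_eq_zero {n d : ℕ} {σ : ℝ} (hσ : 0 < σ) {A : Matrix (Fin n) (Fin d) ℝ}
    (hA : (A * Aᵀ).det = 0) :
    (Measure.pi fun _ : Fin n => noiseLaw σ) (Set.range (A *ᵥ ·)) = 0 := by
  refine pi_noiseLaw_absolutelyContinuous n hσ ?_
  obtain ⟨u, hu0, huA⟩ := exists_vecMul_eq_zero_of_det_mul_transpose_eq_zero hA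
  have hne : LinearMap.range A.mulVecLin ≠ ⊤ := by
    intro htop
    obtain ⟨v, hv⟩ : u ∈ LinearMap.range A.mulVecLin := htop ▸ Submodule.mem_top
    refine hu0 (dotProduct_self_eq_zero.1 ?_)
    nth_rw 2 [← hv]
    rw [Matrix.mulVecLin_apply, Matrix.dotProduct_mulVec, huA, zero_dotProduct]
  exact Measure.addHaar_submodule volume _ hne

/-- Small-ball estimate for the smallest solution of `A α = w` with Gaussian `w`. -/
theorem pi_noiseLaw_exists_apply_eq_le {n d : ℕ} {σ : ℝ} (hσ : 0 < σ)
    (A : Matrix (Fin n) (Fin d) ℝ) {s : ℝ} (hs : 0 < s) (R : ℝ) :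
    (Measure.pi fun _ : Fin n => noiseLaw σ)
        {w | ∃ α : E d, ‖α‖ ^ 2 ≤ R ∧ apply A α = WithLp.toLp 2 w} ≤
      ENNReal.ofReal (Real.exp (s * R) *
        √((A * Aᵀ).det / (A * Aᵀ + (2 * s * σ ^ 2) • 1).det)) := by
  -- For singular `A Aᵀ` the right-hand side is `0`, so the event itself has to be null.
  by_cases hA : (A * Aᵀ).det = 0
  · refine (measure_mono_null ?_ (pi_noiseLaw_range_eq_zero hσ hA)).trans_le zero_le
    rintro w ⟨α, -, hα⟩
    exact ⟨α.ofLp, congrArg WithLp.ofLp hα⟩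
  set G := A * Aᵀ with hG
  have hGpsd : G.PosSemidef := by
    simpa [hG, Matrix.conjTranspose_eq_transpose_of_trivial] using
      Matrix.posSemidef_self_mul_conjTranspose A
  set μ := Measure.pi fun _ : Fin n => noiseLaw σ
  -- Chernoff bound: an interpolant of squared norm at most `R` forces `wᵀ G⁻¹ w ≤ R`, and Markov's
  -- inequality is applied to `exp (-s wᵀ G⁻¹ w)`.
  have hsub : {w | ∃ α : E d, ‖α‖ ^ 2 ≤ R ∧ apply A α = WithLp.toLp 2 w} ⊆
      {w | ENNReal.ofReal (Real.exp (-(s * R))) ≤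
        ENNReal.ofReal (Real.exp (-(s * (w ⬝ᵥ G⁻¹ *ᵥ w))))} := by
    rintro w ⟨α, hα, hw⟩
    have hw' : A *ᵥ α.ofLp = w := congrArg WithLp.ofLp hw
    have := dotProduct_inv_mulVec_le_norm_sq hA α
    rw [hw'] at this
    refine ENNReal.ofReal_le_ofReal (Real.exp_le_exp.2 (neg_le_neg ?_))
    exact mul_le_mul_of_nonneg_left (this.trans hα) hs.le
  have hdet : (1 + (2 * s * σ ^ 2) • G⁻¹).det = (G + (2 * s * σ ^ 2) • 1).det / G.det := by
    rw [eq_div_iff hA, ← Matrix.det_mul, add_mul, one_mul, smul_mul_assoc,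
      Matrix.nonsing_inv_mul _ (Ne.isUnit hA)]
  refine (measure_mono hsub).trans ((meas_ge_le_lintegral_div (by fun_prop) (by simp [Real.exp_pos])
    ENNReal.ofReal_ne_top).trans_eq ?_)
  rw [lintegral_exp_neg_quadratic hσ hs.le hGpsd.inv, hdet, ← Real.sqrt_inv, inv_div,
    ← ENNReal.ofReal_div_of_pos (Real.exp_pos _), Real.exp_neg, div_inv_eq_mul, mul_comm]

end Gaussian

/-! ## Gram determinants of random rows -/

section Gram

open scoped Matrix

theorem posSemidef_mul_transpose {ι κ : Type*} [Fintype ι] [Fintype κ] (A : Matrix ι κ ℝ) :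
    (A * Aᵀ).PosSemidef := by
  simpa [Matrix.conjTranspose_eq_transpose_of_trivial] using
    Matrix.posSemidef_self_mul_conjTranspose A

/-- Adjoining a row multiplies the Gram determinant by the squared distance of the new row to the
span of the others. -/
theorem det_fromRows_mul_transpose {ι κ : Type*} [Fintype ι] [DecidableEq ι] [Fintype κ]
    [DecidableEq κ] (B : Matrix ι κ ℝ) (y : κ → ℝ) :
    (B.fromRows (Matrix.replicateRow Unit y) * (B.fromRows (Matrix.replicateRow Unit y))ᵀ).det =
      (B * Bᵀ).det * (y ⬝ᵥ (1 - Bᵀ * (B * Bᵀ)⁻¹ * B) *ᵥ y) := by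
  -- Dependent rows stay dependent after adjoining one, so both sides vanish. Otherwise the last
  -- factor is the Schur complement.
  by_cases hB : (B * Bᵀ).det = 0
  · obtain ⟨u, hu0, hu⟩ := exists_vecMul_eq_zero_of_det_mul_transpose_eq_zero hB
    rw [hB, zero_mul, ← Matrix.exists_vecMul_eq_zero_iff]
    refine ⟨Sum.elim u 0, fun h => hu0 ?_, ?_⟩
    · ext j
      exact congrFun h (Sum.inl j)
    · rw [← Matrix.vecMul_vecMul, Matrix.sumElim_vecMul_fromRows, hu]
      simp
  · let _ : Invertible (B * Bᵀ) := Matrix.invertibleOfIsUnitDet _ (Ne.isUnit hB)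
    rw [Matrix.transpose_fromRows, Matrix.fromRows_mul_fromCols, Matrix.det_fromBlocks₁₁,
      Matrix.det_unique (n := Unit), Matrix.invOf_eq_nonsing_inv]
    congr 1
    rw [Matrix.sub_mulVec, Matrix.one_mulVec, dotProduct_sub, Matrix.sub_apply]
    congr 1
    rw [← Matrix.mulVec_mulVec, ← Matrix.mulVec_mulVec]
    simp only [Matrix.mul_assoc, Matrix.transpose_replicateRow]
    rw [← Matrix.replicateCol_mulVec, ← Matrix.replicateCol_mulVec, ← Matrix.replicateCol_mulVec]
    rfl

/-- The Gram determinant of the rows of `A` in `S`. -/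
def gramDet {n d : ℕ} (A : Matrix (Fin n) (Fin d) ℝ) (S : Finset (Fin n)) : ℝ :=
  ((A * Aᵀ).submatrix (Subtype.val : S → Fin n) (Subtype.val : S → Fin n)).det

variable {n d p : ℕ}

theorem gramDet_nonneg (A : Matrix (Fin n) (Fin d) ℝ) (S : Finset (Fin n)) : 0 ≤ gramDet A S :=
  ((posSemidef_mul_transpose A).submatrix _).det_nonneg

theorem gramDet_pos {A : Matrix (Fin n) (Fin d) ℝ} (hA : (A * Aᵀ).det ≠ 0) (S : Finset (Fin n)) :
    0 < gramDet A S :=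
  ((((posSemidef_mul_transpose A).posDef_iff_isUnit).2
    ((Matrix.isUnit_iff_isUnit_det _).2 (Ne.isUnit hA))).submatrix Subtype.val_injective).det_pos

theorem gramDet_univ (A : Matrix (Fin n) (Fin d) ℝ) :
    gramDet A Finset.univ = (A * Aᵀ).det :=
  Matrix.det_submatrix_equiv_self (Equiv.subtypeUnivEquiv Finset.mem_univ) (A * Aᵀ)

theorem gramDet_congr {A B : Matrix (Fin n) (Fin d) ℝ} {S : Finset (Fin n)}
    (h : ∀ i ∈ S, A i = B i) : gramDet A S = gramDet B S := by
  unfold gramDet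
  congr 1
  ext i j
  simp [Matrix.mul_apply, h i i.2, h j j.2]

theorem gramDet_insert (A : Matrix (Fin n) (Fin d) ℝ) {S : Finset (Fin n)} {i : Fin n}
    (hi : i ∉ S) :
    gramDet A (insert i S) =
      gramDet A S * (A i ⬝ᵥ (1 - (A.submatrix (Subtype.val : S → Fin n) id)ᵀ *
        (A.submatrix (Subtype.val : S → Fin n) id *
          (A.submatrix (Subtype.val : S → Fin n) id)ᵀ)⁻¹ *
        A.submatrix (Subtype.val : S → Fin n) id) *ᵥ A i) := by
  set B := A.submatrix (Subtype.val : S → Fin n) id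
  have hB : gramDet A S = (B * Bᵀ).det := rfl
  rw [hB, ← det_fromRows_mul_transpose]
  let e : { j // j ∈ insert i S } ≃ S ⊕ Unit :=
    (Finset.subtypeInsertEquivOption hi).trans (Equiv.optionEquivSumPUnit _)
  rw [gramDet, ← Matrix.det_submatrix_equiv_self e.symm]
  congr 1
  have hrow : B.fromRows (Matrix.replicateRow Unit (A i)) =
      A.submatrix (fun k => ((e.symm k : { j // j ∈ insert i S }) : Fin n)) id := by
    ext (k | k) c
    · simp [e, B, Finset.subtypeInsertEquivOption]
    · simp [e, Finset.subtypeInsertEquivOption]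
  rw [hrow]
  rfl

theorem measurable_gramDet_trainMatrix {a : E p → E d} (ha : Measurable a) (S : Finset (Fin n)) :
    Measurable fun x : Fin n → E p => gramDet (trainMatrix a x) S := by
  have h1 : Measurable fun (x : Fin n → E p) (i : Fin n) (j : Fin d) => a (x i) j := by
    fun_prop
  have h2 : Continuous fun A : Fin n → Fin d → ℝ => gramDet (Matrix.of A) S := by
    unfold gramDet
    fun_prop
  exact h2.measurable.comp h1

/-! ### Expected Gram determinants of whitened rows. -/

section Whitened

variable {ν : Measure (E p)} {a : E p → E d}

theorem IsWhitened.integrable_mul (h : IsWhitened ν a) (ha : Measurable a) (i j : Fin d) :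
    Integrable (fun x => a x i * a x j) ν := by
  have hsq : ∀ i, MemLp (fun x => a x i) 2 ν := fun i => by
    rw [memLp_two_iff_integrable_sq (by fun_prop)]
    -- A nonintegrable square would have integral `0` by convention, but whitening says `1`.
    by_contra hni
    have := h i i
    simp only [← sq, if_true] at this
    rw [integral_undef hni] at this
    norm_num at this
  exact (hsq i).integrable_mul (hsq j)

theorem IsWhitened.integrable_quadratic (h : IsWhitened ν a) (ha : Measurable a)
    (P : Matrix (Fin d) (Fin d) ℝ) :
    Integrable (fun x => (a x).ofLp ⬝ᵥ P *ᵥ (a x).ofLp) ν := by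
  simp only [dotProduct, Matrix.mulVec, Finset.mul_sum]
  refine integrable_finsetSum _ fun i _ => integrable_finsetSum _ fun j _ => ?_
  refine ((h.integrable_mul ha i j).const_mul (P i j)).congr (ae_of_all _ fun x => ?_)
  simp only
  ring

theorem IsWhitened.integral_quadratic (h : IsWhitened ν a) (ha : Measurable a)
    (P : Matrix (Fin d) (Fin d) ℝ) :
    ∫ x, (a x).ofLp ⬝ᵥ P *ᵥ (a x).ofLp ∂ν = P.trace := by
  have hint : ∀ i j, Integrable (fun x => P i j * (a x i * a x j)) ν := fun i j =>
    (h.integrable_mul ha i j).const_mul (P i j)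
  have heq : ∀ x, (a x).ofLp ⬝ᵥ P *ᵥ (a x).ofLp = ∑ i, ∑ j, P i j * (a x i * a x j) := fun x => by
    simp only [dotProduct, Matrix.mulVec, Finset.mul_sum]
    exact Finset.sum_congr rfl fun i _ => Finset.sum_congr rfl fun j _ => by ring
  simp only [heq]
  rw [integral_finsetSum _ fun i _ => integrable_finsetSum _ fun j _ => hint i j]
  simp only [integral_finsetSum _ fun j _ => hint _ j, integral_const_mul, h _ _]
  simp [Matrix.trace]

/-- For independent rows, `P` is the orthogonal projection off their span, and whitening gives `𝔼[aᵀ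
P a] = tr P = d - |S|`. For dependent rows `P` has no such meaning, but the factor `gramDet` is then
`0`. -/
theorem lintegral_gramDet_insert (h : IsWhitened ν a) (ha : Measurable a) {S : Finset (Fin n)}
    {i : Fin n} (hi : i ∉ S) (x : Fin n → E p) :
    ∫⁻ y, ENNReal.ofReal (gramDet (trainMatrix a (Function.update x i y)) (insert i S)) ∂ν =
      ENNReal.ofReal ((d : ℝ) - S.card) * ENNReal.ofReal (gramDet (trainMatrix a x) S) := by
  set B := (trainMatrix a x).submatrix (Subtype.val : S → Fin n) id with hB
  set P := 1 - Bᵀ * (B * Bᵀ)⁻¹ * B with hP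
  have hrows : ∀ y, ∀ j ∈ S, trainMatrix a (Function.update x i y) j = trainMatrix a x j :=
    fun y j hj => by
      ext c
      simp [trainMatrix, Function.update_of_ne (ne_of_mem_of_not_mem hj hi)]
  have hins : ∀ y, gramDet (trainMatrix a (Function.update x i y)) (insert i S) =
      gramDet (trainMatrix a x) S * ((a y).ofLp ⬝ᵥ P *ᵥ (a y).ofLp) := fun y => by
    have hBy : (trainMatrix a (Function.update x i y)).submatrix (Subtype.val : S → Fin n) id =
        B := by
      ext j c
      exact congrFun (hrows y j j.2) c
    rw [gramDet_insert _ hi, hBy, gramDet_congr (hrows y)]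
    have : trainMatrix a (Function.update x i y) i = (a y).ofLp := by
      ext c
      simp [trainMatrix]
    rw [this]
  have htrace : gramDet (trainMatrix a x) S * P.trace =
      ((d : ℝ) - S.card) * gramDet (trainMatrix a x) S := by
    by_cases hdet : (B * Bᵀ).det = 0
    · have : gramDet (trainMatrix a x) S = 0 := hdet
      simp [this]
    · rw [mul_comm, hP, Matrix.trace_sub, Matrix.trace_one, Matrix.mul_assoc, Matrix.trace_mul_comm,
        Matrix.mul_assoc, Matrix.nonsing_inv_mul _ (Ne.isUnit hdet), Matrix.trace_one]
      simp
  have hcomm : (fun y => gramDet (trainMatrix a (Function.update x i y)) (insert i S)) =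
      fun y => gramDet (trainMatrix a x) S * ((a y).ofLp ⬝ᵥ P *ᵥ (a y).ofLp) := funext hins
  have hint : Integrable (fun y =>
      gramDet (trainMatrix a (Function.update x i y)) (insert i S)) ν := by
    rw [hcomm]
    exact (h.integrable_quadratic ha P).const_mul _
  rw [← ofReal_integral_eq_lintegral_ofReal hint (ae_of_all _ fun y => gramDet_nonneg _ _), hcomm,
    integral_const_mul, h.integral_quadratic ha, htrace, ENNReal.ofReal_mul' (gramDet_nonneg _ _)]

variable [IsProbabilityMeasure ν]

/-- The rows in `V` are integrated out one at a time, each contributing `d` minus the number of rows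
still present. -/
theorem lmarginal_gramDet_union (h : IsWhitened ν a) (ha : Measurable a) (T V : Finset (Fin n))
    (hTV : Disjoint T V) :
    lmarginal (fun _ : Fin n => ν) V
        (fun x => ENNReal.ofReal (gramDet (trainMatrix a x) (T ∪ V))) =
      fun x => (∏ j ∈ Finset.range V.card, ENNReal.ofReal ((d : ℝ) - (T.card + j : ℕ))) *
        ENNReal.ofReal (gramDet (trainMatrix a x) T) := by
  induction V using Finset.induction with
  | empty => simp
  | @insert i V hi ih =>
    have hTV' : Disjoint T V := hTV.mono_right (Finset.subset_insert i V)
    have hiT : i ∉ T := Finset.disjoint_right.1 hTV (Finset.mem_insert_self i V)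
    have hiU : i ∉ T ∪ V := by simp [hi, hiT]
    rw [lmarginal_insert' _ (measurable_gramDet_trainMatrix ha _).ennreal_ofReal hi]
    simp only [Finset.union_insert, lintegral_gramDet_insert h ha hiU]
    have hpull : ∀ (c : ENNReal) (f : (Fin n → E p) → ENNReal), Measurable f →
        lmarginal (fun _ : Fin n => ν) V (fun x => c * f x) =
          fun x => c * lmarginal (fun _ : Fin n => ν) V f x := fun c f hf => by
      ext x
      exact lintegral_const_mul c (hf.comp measurable_updateFinset)
    rw [hpull _ _ (measurable_gramDet_trainMatrix ha _).ennreal_ofReal, ih hTV']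
    ext x
    rw [Finset.card_insert_of_notMem hi, Finset.prod_range_succ,
      Finset.card_union_of_disjoint hTV']
    ring

/-- The expected ratio of the Gram determinant of all rows to that of the rows in `T`. -/
theorem lintegral_gramDet_univ_div_le (h : IsWhitened ν a) (ha : Measurable a)
    (T : Finset (Fin n)) :
    ∫⁻ x, ENNReal.ofReal (gramDet (trainMatrix a x) Finset.univ) /
        ENNReal.ofReal (gramDet (trainMatrix a x) T) ∂(Measure.pi fun _ : Fin n => ν) ≤
      ∏ j ∈ Finset.range (n - T.card), ENNReal.ofReal ((d : ℝ) - (T.card + j : ℕ)) := by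
  set c := ∏ j ∈ Finset.range (n - T.card), ENNReal.ofReal ((d : ℝ) - (T.card + j : ℕ))
  have hmU := (measurable_gramDet_trainMatrix (n := n) ha Finset.univ).ennreal_ofReal
  have hmT := (measurable_gramDet_trainMatrix (n := n) ha T).ennreal_ofReal
  -- With the rows in `T` frozen the denominator is constant. Only an inequality results, because `0
  -- * 0⁻¹ = 0` where the minor vanishes.
  have key : ∀ x, lmarginal (fun _ : Fin n => ν) Tᶜ (fun x =>
      ENNReal.ofReal (gramDet (trainMatrix a x) Finset.univ) /
        ENNReal.ofReal (gramDet (trainMatrix a x) T)) x ≤ c := fun x => by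
    have hT : ∀ y : (∀ _ : (Tᶜ : Finset (Fin n)), E p),
        gramDet (trainMatrix a (Function.updateFinset x Tᶜ y)) T = gramDet (trainMatrix a x) T :=
      fun y => gramDet_congr fun i hi => by
        ext k
        simp [trainMatrix, Function.updateFinset, hi]
    have hmarg := congrFun (lmarginal_gramDet_union h ha T Tᶜ disjoint_compl_right) x
    rw [Finset.union_compl, Finset.card_compl, Fintype.card_fin, lmarginal] at hmarg
    simp only [lmarginal, hT, div_eq_mul_inv]
    have hmy : Measurable fun y : (∀ _ : (Tᶜ : Finset (Fin n)), E p) =>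
        ENNReal.ofReal (gramDet (trainMatrix a (Function.updateFinset x Tᶜ y)) Finset.univ) :=
      hmU.comp measurable_updateFinset
    rw [lintegral_mul_const _ hmy, hmarg, mul_assoc]
    exact mul_le_of_le_one_right' (ENNReal.mul_inv_le_one _)
  have hmeas : Measurable fun x : Fin n → E p =>
      ENNReal.ofReal (gramDet (trainMatrix a x) Finset.univ) /
        ENNReal.ofReal (gramDet (trainMatrix a x) T) := hmU.div hmT
  rcases isEmpty_or_nonempty (Fin n → E p) with _ | ⟨⟨x⟩⟩
  · simp [lintegral_of_isEmpty]
  have hunion := congrFun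
    (lmarginal_union (fun _ : Fin n => ν) _ hmeas (disjoint_compl_right (a := T))) x
  rw [Finset.union_compl] at hunion
  rw [lintegral_eq_lmarginal_univ x, hunion]
  refine (lmarginal_mono key x).trans_eq ?_
  simp [lmarginal]

end Whitened

/-- A lower bound for `det (M + τ I)` by principal minors. -/
theorem pow_mul_sum_gramDet_le_det_add {A : Matrix (Fin n) (Fin d) ℝ} {τ : ℝ} (hτ : 0 < τ) {k : ℕ}
    (hk : k ≤ n) :
    τ ^ k * ∑ T ∈ Finset.univ.powersetCard (n - k), gramDet A T ≤ (A * Aᵀ + τ • 1).det := by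
  set G := A * Aᵀ with hG
  -- The coefficients of `det (1 + X G)` are sums of principal minors, all nonnegative, so its value
  -- at `τ⁻¹` is at least the single term of degree `n - k`.
  open Polynomial in
  set q : ℝ[X] := (1 + (X : ℝ[X]) • G.map C).det with hq
  have hcoeff : ∀ m, q.coeff m = ∑ T ∈ Finset.univ.powersetCard m, gramDet A T := fun m =>
    Matrix.coeff_det_one_add_X_smul_eq_sum_minors G m
  have heval : q.eval τ⁻¹ = (1 + τ⁻¹ • G).det := by
    rw [hq, ← Polynomial.coe_evalRingHom, RingHom.map_det]
    congr 1
    ext i j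
    by_cases hij : i = j <;> simp [hij, mul_comm τ⁻¹]
  have hdet : (G + τ • 1).det = τ ^ n * (1 + τ⁻¹ • G).det := by
    have : G + τ • 1 = τ • (1 + τ⁻¹ • G) := by
      rw [smul_add, smul_smul, mul_inv_cancel₀ hτ.ne', one_smul, add_comm]
    rw [this, Matrix.det_smul, Fintype.card_fin]
  have hle : q.coeff (n - k) * τ⁻¹ ^ (n - k) ≤ q.eval τ⁻¹ := by
    rw [Polynomial.eval_eq_sum_range' (n := max (q.natDegree + 1) (n - k + 1)) (by omega)]
    refine Finset.single_le_sum (f := fun m => q.coeff m * τ⁻¹ ^ m) (fun m _ => ?_)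
      (Finset.mem_range.2 (by omega))
    rw [hcoeff]
    exact mul_nonneg (Finset.sum_nonneg fun T _ => gramDet_nonneg A T) (by positivity)
  rw [hdet, ← heval, ← hcoeff]
  calc τ ^ k * q.coeff (n - k) = τ ^ n * (q.coeff (n - k) * τ⁻¹ ^ (n - k)) := by
        obtain ⟨l, rfl⟩ := Nat.exists_eq_add_of_le hk
        rw [Nat.add_sub_cancel_left, pow_add, inv_pow]
        field_simp
    _ ≤ _ := by gcongr

/-- The minors have to leave the denominator before expectations are taken. Cauchy–Schwarz, `N ^ 2 /
∑ g_T ≤ ∑ 1 / g_T` over the `N = n.choose k` sets, does this. -/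
theorem det_div_det_add_le (A : Matrix (Fin n) (Fin d) ℝ) {τ : ℝ} (hτ : 0 < τ) {k : ℕ}
    (hk : k ≤ n) :
    ENNReal.ofReal ((A * Aᵀ).det / (A * Aᵀ + τ • 1).det) ≤
      ENNReal.ofReal (τ ^ k * (n.choose k : ℝ) ^ 2)⁻¹ *
        ∑ T ∈ Finset.univ.powersetCard (n - k),
          ENNReal.ofReal (gramDet A Finset.univ) / ENNReal.ofReal (gramDet A T) := by
  by_cases hA : (A * Aᵀ).det = 0
  · simp [hA]
  have hpos := gramDet_pos hA
  have hcard : ((Finset.univ : Finset (Fin n)).powersetCard (n - k)).card = n.choose k := by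
    rw [Finset.card_powersetCard, Finset.card_univ, Fintype.card_fin, Nat.choose_symm hk]
  have hN : (0 : ℝ) < n.choose k := by exact_mod_cast Nat.choose_pos hk
  have hne : ((Finset.univ : Finset (Fin n)).powersetCard (n - k)).Nonempty := by
    rw [← Finset.card_pos, hcard]
    exact Nat.choose_pos hk
  have hsum := Finset.sum_pos (fun T _ => hpos T) hne
  simp only [← ENNReal.ofReal_div_of_pos (hpos _)]
  rw [← ENNReal.ofReal_sum_of_nonneg fun T _ => div_nonneg (hpos _).le (hpos _).le,
    ← ENNReal.ofReal_mul (by positivity), ← gramDet_univ]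
  refine ENNReal.ofReal_le_ofReal ?_
  have hcs := Finset.sq_sum_div_le_sum_sq_div ((Finset.univ : Finset (Fin n)).powersetCard (n - k))
    (fun _ => (1 : ℝ)) (fun T _ => hpos T)
  simp only [Finset.sum_const, hcard, nsmul_eq_mul, mul_one, one_pow] at hcs
  calc gramDet A Finset.univ / (A * Aᵀ + τ • 1).det
      ≤ gramDet A Finset.univ /
          (τ ^ k * ∑ T ∈ Finset.univ.powersetCard (n - k), gramDet A T) := by
        gcongr
        · exact (hpos _).le
        · exact pow_mul_sum_gramDet_le_det_add hτ hk
    _ = (τ ^ k * (n.choose k : ℝ) ^ 2)⁻¹ * (gramDet A Finset.univ * ((n.choose k : ℝ) ^ 2 /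
          ∑ T ∈ Finset.univ.powersetCard (n - k), gramDet A T)) := by
        field_simp
    _ ≤ (τ ^ k * (n.choose k : ℝ) ^ 2)⁻¹ * (gramDet A Finset.univ *
          ∑ T ∈ Finset.univ.powersetCard (n - k), 1 / gramDet A T) := by
        gcongr
        exact (hpos _).le
    _ = _ := by
        simp only [Finset.mul_sum, mul_one_div]

/-- Each `T` has `n - k` rows, so each of the `k` rows integrated out costs a factor at most `d - n
+ k`. Summing over `n.choose k` sets cancels one power of the binomial. -/
theorem lintegral_det_div_det_add_le {ν : Measure (E p)} [IsProbabilityMeasure ν] {a : E p → E d}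
    (h : IsWhitened ν a) (ha : Measurable a) (hnd : n ≤ d) {τ : ℝ} (hτ : 0 < τ) {k : ℕ}
    (hk : k ≤ n) :
    ∫⁻ x, ENNReal.ofReal ((trainMatrix a x * (trainMatrix a x)ᵀ).det /
        (trainMatrix a x * (trainMatrix a x)ᵀ + τ • 1).det) ∂(Measure.pi fun _ : Fin n => ν) ≤
      ENNReal.ofReal (((d : ℝ) - n + k) ^ k / (τ ^ k * n.choose k)) := by
  have hm : ∀ T : Finset (Fin n), Measurable fun x : Fin n → E p =>
      ENNReal.ofReal (gramDet (trainMatrix a x) Finset.univ) /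
        ENNReal.ofReal (gramDet (trainMatrix a x) T) := fun T =>
    (measurable_gramDet_trainMatrix ha _).ennreal_ofReal.div
      (measurable_gramDet_trainMatrix ha _).ennreal_ofReal
  have hN : (0 : ℝ) < n.choose k := by exact_mod_cast Nat.choose_pos hk
  have hnd' : (n : ℝ) ≤ d := by exact_mod_cast hnd
  have hpow : ∀ T ∈ (Finset.univ : Finset (Fin n)).powersetCard (n - k),
      ∫⁻ x, ENNReal.ofReal (gramDet (trainMatrix a x) Finset.univ) /
        ENNReal.ofReal (gramDet (trainMatrix a x) T) ∂(Measure.pi fun _ : Fin n => ν) ≤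
      ENNReal.ofReal (((d : ℝ) - n + k) ^ k) := fun T hT => by
    have hT' := (Finset.mem_powersetCard.1 hT).2
    refine (lintegral_gramDet_univ_div_le h ha T).trans ?_
    rw [hT', Nat.sub_sub_self hk, ENNReal.ofReal_pow (by linarith [(Nat.cast_nonneg k : (0:ℝ) ≤ k)])]
    calc _ ≤ ∏ j ∈ Finset.range k, ENNReal.ofReal ((d : ℝ) - n + k) := by
          refine Finset.prod_le_prod' fun j _ => ENNReal.ofReal_le_ofReal ?_
          push_cast [Nat.cast_sub hk]
          linarith [(Nat.cast_nonneg j : (0:ℝ) ≤ j)]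
      _ = _ := by simp
  refine (lintegral_mono fun x => det_div_det_add_le (trainMatrix a x) hτ hk).trans ?_
  rw [lintegral_const_mul _ (Finset.measurable_fun_sum _ fun T _ => hm T),
    lintegral_finsetSum _ fun T _ => hm T]
  refine (mul_le_mul_right (Finset.sum_le_card_nsmul _ _ _ hpow) _).trans_eq ?_
  rw [Finset.card_powersetCard, Finset.card_univ, Fintype.card_fin, Nat.choose_symm hk,
    nsmul_eq_mul, ← ENNReal.ofReal_natCast, ← ENNReal.ofReal_mul hN.le,
    ← ENNReal.ofReal_mul (by positivity)]
  congr 1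
  field_simp

end Gram

/-! ## Small interpolants of pure noise, few features -/

section SmallBall

open scoped Matrix

variable {n d p : ℕ}

/-- Projection along a compact factor is closed. This makes the existence of an interpolant in a
compact set a measurable event, so that Fubini applies. -/
theorem isClosed_exists_apply_eq {K : Set (E d)} (hK : IsCompact K) :
    IsClosed {q : (Fin n → Fin d → ℝ) × E n | ∃ α ∈ K, apply (Matrix.of q.1) α = q.2} := by
  have : CompactSpace K := isCompact_iff_compactSpace.1 hK
  have hcont : Continuous fun r : ((Fin n → Fin d → ℝ) × E n) × K =>
      apply (Matrix.of r.1.1) (r.2 : E d) := by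
    unfold apply
    have h1 : Continuous fun r : ((Fin n → Fin d → ℝ) × E n) × K => Matrix.of r.1.1 :=
      continuous_fst.fst
    have h2 : Continuous fun r : ((Fin n → Fin d → ℝ) × E n) × K => (r.2 : E d).ofLp := by
      fun_prop
    exact (PiLp.continuous_toLp 2 _).comp (h1.matrix_mulVec h2)
  have hclosed : IsClosed {r : ((Fin n → Fin d → ℝ) × E n) × K |
      apply (Matrix.of r.1.1) (r.2 : E d) = r.1.2} :=
    isClosed_eq hcont (by fun_prop)
  have himage : {q : (Fin n → Fin d → ℝ) × E n | ∃ α ∈ K, apply (Matrix.of q.1) α = q.2} =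
      Prod.fst '' {r : ((Fin n → Fin d → ℝ) × E n) × K |
        apply (Matrix.of r.1.1) (r.2 : E d) = r.1.2} := by
    ext q
    constructor
    · rintro ⟨α, hα, h⟩
      exact ⟨(q, ⟨α, hα⟩), h, rfl⟩
    · rintro ⟨⟨q, α⟩, h, rfl⟩
      exact ⟨α, α.2, h⟩
  rw [himage]
  exact isClosedMap_fst_of_compactSpace _ hclosed

theorem measurable_trainOutput {a : E p → E d} (ha : Measurable a) (αstar : E d) :
    Measurable fun z : (Fin n → E p) × (Fin n → ℝ) => trainOutput a αstar z.1 z.2 := by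
  unfold trainOutput
  fun_prop

theorem measurableSet_exists_apply_eq {a : E p → E d} (ha : Measurable a) (αstar : E d)
    {K : Set (E d)} (hK : IsCompact K) :
    MeasurableSet {z : (Fin n → E p) × (Fin n → ℝ) |
      ∃ α ∈ K, apply (trainMatrix a z.1) α = trainOutput a αstar z.1 z.2} := by
  have hm : Measurable fun z : (Fin n → E p) × (Fin n → ℝ) =>
      ((fun i j => a (z.1 i) j : Fin n → Fin d → ℝ), trainOutput a αstar z.1 z.2) :=
    Measurable.prodMk (by fun_prop) (measurable_trainOutput ha αstar)
  exact hm (isClosed_exists_apply_eq hK).measurableSet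

theorem trainOutput_zero (a : E p → E d) (x : Fin n → E p) (w : Fin n → ℝ) :
    trainOutput a 0 x w = WithLp.toLp 2 w := by
  simp [trainOutput]

theorem pow_le_pow_mul_choose {n m : ℕ} (h : m ≤ n) : n ^ m ≤ m ^ m * n.choose m := by
  induction m generalizing n with
  | zero => simp
  | succ m ih =>
    obtain ⟨n, rfl⟩ : ∃ k, n = k + 1 := ⟨n - 1, by omega⟩
    have hmn : m ≤ n := by omega
    have key : (n + 1) ^ m ≤ (m + 1) ^ m * n.choose m := by
      rcases Nat.eq_zero_or_pos m with rfl | hm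
      · simp
      · refine Nat.le_of_mul_le_mul_left ?_ (pow_pos hm m)
        calc m ^ m * (n + 1) ^ m = (m * (n + 1)) ^ m := (mul_pow _ _ _).symm
          -- The base inequality `m (n + 1) ≤ (m + 1) n` is just `m ≤ n`.
          _ ≤ ((m + 1) * n) ^ m := Nat.pow_le_pow_left (by nlinarith) m
          _ = (m + 1) ^ m * n ^ m := mul_pow _ _ _
          _ ≤ (m + 1) ^ m * (m ^ m * n.choose m) := Nat.mul_le_mul_left _ (ih hmn)
          _ = _ := by ring
    calc (n + 1) ^ (m + 1) = (n + 1) * (n + 1) ^ m := by ring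
      _ ≤ (n + 1) * ((m + 1) ^ m * n.choose m) := Nat.mul_le_mul_left _ key
      _ = (m + 1) ^ m * ((n + 1) * n.choose m) := by ring
      _ = (m + 1) ^ m * ((n + 1).choose (m + 1) * (m + 1)) := by rw [Nat.add_one_mul_choose_eq]
      _ = _ := by ring

/-- AM–GM linearizes the square root, so a bound `q ^ 2` on the mean of `ρ` yields `q` on the mean
of `√ρ`. -/
theorem sqrt_le_add_div_two {ρ q : ℝ} (hρ : 0 ≤ ρ) (hq : 0 < q) : √ρ ≤ (ρ / q + q) / 2 := by
  have h := sq_nonneg (√ρ - q)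
  rw [le_div_iff₀ two_pos, ← sub_nonneg]
  have h2 : ρ / q + q - √ρ * 2 = (√ρ - q) ^ 2 / q := by
    field_simp
    ring_nf
    rw [Real.sq_sqrt hρ]
    ring
  rw [h2]
  positivity

/-- If there are at most `n` more features than samples, then with high probability every
interpolant of the noise has large norm. -/
theorem trainLaw_exists_interpolant_le {ν : Measure (E p)} [IsProbabilityMeasure ν]
    {a : E p → E d} (h : IsWhitened ν a) (ha : Measurable a) {σ : ℝ} (hσ : 0 < σ) {m : ℕ}
    (hm : 0 < m) (hmn : m ≤ n) (hd : d = n + m) :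
    trainLaw n ν σ {z | ∃ α : E d, ‖α‖ ^ 2 ≤ σ ^ 2 * n / (Real.exp 4 * m) ∧
        apply (trainMatrix a z.1) α = trainOutput a 0 z.1 z.2} ≤
      ENNReal.ofReal (Real.exp (-m)) := by
  have hm' : (0 : ℝ) < m := by exact_mod_cast hm
  have hn' : (0 : ℝ) < n := by exact_mod_cast hm.trans_le hmn
  set R := σ ^ 2 * n / (Real.exp 4 * m) with hR
  have hR0 : 0 < R := by positivity
  -- This makes the Chernoff factor `exp (s R) = exp m`.
  set s := m / R with hs
  have hs0 : 0 < s := by positivity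
  have hτ0 : 0 < 2 * s * σ ^ 2 := by positivity
  have hmeas : MeasurableSet {z : (Fin n → E p) × (Fin n → ℝ) | ∃ α : E d, ‖α‖ ^ 2 ≤ R ∧
      apply (trainMatrix a z.1) α = trainOutput a 0 z.1 z.2} := by
    have := measurableSet_exists_apply_eq (n := n) ha 0
      (isCompact_closedBall (0 : E d) (√R))
    convert this using 5
    rw [mem_closedBall_zero_iff, Real.le_sqrt (norm_nonneg _) hR0.le]
  -- The mean ratio is at most `(2m · m / (τ n)) ^ m` with `τ = 2sσ²`. The factor `exp 4` in `R`
  -- makes this `exp (-4m) = q ^ 2`, and finally `exp m · q = exp (-m)`.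
  set q := Real.exp (-2 * m) with hq
  have hq0 : 0 < q := Real.exp_pos _
  set ρ : (Fin n → E p) → ℝ := fun x => (trainMatrix a x * (trainMatrix a x)ᵀ).det /
    (trainMatrix a x * (trainMatrix a x)ᵀ + (2 * s * σ ^ 2) • 1).det with hρ
  have hρ0 : ∀ x, 0 ≤ ρ x := fun x => by
    have h1 := posSemidef_mul_transpose (trainMatrix a x)
    exact div_nonneg h1.det_nonneg (h1.add (Matrix.PosSemidef.one.smul hτ0.le)).det_nonneg
  have hEρ : ∫⁻ x, ENNReal.ofReal (ρ x) ∂(Measure.pi fun _ : Fin n => ν) ≤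
      ENNReal.ofReal (q ^ 2) := by
    refine (lintegral_det_div_det_add_le h ha (by omega) hτ0 hmn).trans
      (ENNReal.ofReal_le_ofReal ?_)
    have hchoose : (n : ℝ) ^ m ≤ (m : ℝ) ^ m * n.choose m := by
      exact_mod_cast pow_le_pow_mul_choose hmn
    have hC : (0 : ℝ) < n.choose m := by exact_mod_cast Nat.choose_pos hmn
    rw [div_le_iff₀ (by positivity)]
    have h2 : (d : ℝ) - n + m = 2 * m := by
      rw [hd]
      push_cast
      ring
    have h3 : q ^ 2 = Real.exp (-4) ^ m := by
      rw [hq, ← Real.exp_nat_mul, ← Real.exp_nat_mul]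
      congr 1
      push_cast
      ring
    have h4 : Real.exp (-4) * (2 * s * σ ^ 2) * n = 2 * m * m := by
      rw [hs, hR, Real.exp_neg]
      field_simp
    rw [h2, h3]
    calc (2 * m : ℝ) ^ m = (2 * m * m) ^ m / (m : ℝ) ^ m := by
          rw [mul_pow (2 * m : ℝ) m m]
          field_simp
      _ = Real.exp (-4) ^ m * (2 * s * σ ^ 2) ^ m * (n ^ m / (m : ℝ) ^ m) := by
          rw [← h4, mul_pow, mul_pow]
          ring
      _ ≤ Real.exp (-4) ^ m * (2 * s * σ ^ 2) ^ m * n.choose m := by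
          gcongr
          rwa [div_le_iff₀' (by positivity)]
      _ = _ := by ring
  have hbound : ∀ x, (Measure.pi fun _ : Fin n => noiseLaw σ)
      (Prod.mk x ⁻¹' {z : (Fin n → E p) × (Fin n → ℝ) | ∃ α : E d, ‖α‖ ^ 2 ≤ R ∧
        apply (trainMatrix a z.1) α = trainOutput a 0 z.1 z.2}) ≤
      ENNReal.ofReal (Real.exp m / (2 * q)) * ENNReal.ofReal (ρ x) +
        ENNReal.ofReal (Real.exp m * q / 2) := fun x => by
    simp only [Set.preimage_ofPred_eq, trainOutput_zero]
    refine (pi_noiseLaw_exists_apply_eq_le hσ (trainMatrix a x) hs0 R).trans ?_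
    rw [← ENNReal.ofReal_mul (by positivity), ← ENNReal.ofReal_add
      (mul_nonneg (by positivity) (hρ0 x)) (by positivity)]
    refine ENNReal.ofReal_le_ofReal ?_
    have hsR : s * R = m := div_mul_cancel₀ _ hR0.ne'
    rw [hsR]
    calc Real.exp m * √(ρ x) ≤ Real.exp m * ((ρ x / q + q) / 2) := by
          gcongr
          exact sqrt_le_add_div_two (hρ0 x) hq0
      _ = _ := by
          field_simp
  rw [trainLaw, Measure.prod_apply hmeas]
  refine (lintegral_mono hbound).trans ?_
  rw [lintegral_add_right _ measurable_const, lintegral_const, measure_univ, mul_one,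
    lintegral_const_mul' _ _ ENNReal.ofReal_ne_top]
  refine (add_le_add_left (mul_le_mul_right hEρ _) _).trans_eq ?_
  rw [← ENNReal.ofReal_mul (by positivity), ← ENNReal.ofReal_add (by positivity) (by positivity)]
  congr 1
  have : Real.exp m * q = Real.exp (-m) := by
    rw [hq, ← Real.exp_add]
    congr 1
    ring
  rw [← this]
  field_simp
  ring

/-- The lower tail of the energy of the noise. -/
theorem pi_noiseLaw_norm_sq_le {σ : ℝ} (hσ : 0 < σ) (hn : 0 < n) :
    (Measure.pi fun _ : Fin n => noiseLaw σ)
        {w | ‖(WithLp.toLp 2 w : E n)‖ ^ 2 ≤ Real.exp (-2) * σ ^ 2 * n} ≤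
      ENNReal.ofReal (Real.exp (-(n / 2))) := by
  have hn' : (0 : ℝ) < n := by exact_mod_cast hn
  -- The noise is its own interpolant for the identity matrix. With `2sσ² = exp 2`, the small-ball
  -- estimate reads `exp (n/2) (1 + exp 2) ^ (-n/2) ≤ exp (n/2 - n)`.
  set s := Real.exp 2 / (2 * σ ^ 2) with hs
  have hs0 : 0 < s := by positivity
  have hτ : 2 * s * σ ^ 2 = Real.exp 2 := by
    rw [hs]
    field_simp
  have hsR : s * (Real.exp (-2) * σ ^ 2 * n) = n / 2 := by
    rw [hs, Real.exp_neg]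
    field_simp
  refine (measure_mono fun w hw => ?_).trans ((pi_noiseLaw_exists_apply_eq_le hσ
    (1 : Matrix (Fin n) (Fin n) ℝ) hs0 (Real.exp (-2) * σ ^ 2 * n)).trans ?_)
  · exact ⟨WithLp.toLp 2 w, hw, by simp [apply]⟩
  · refine ENNReal.ofReal_le_ofReal ?_
    have hdet : (1 * 1ᵀ + (2 * s * σ ^ 2) • 1 : Matrix (Fin n) (Fin n) ℝ).det =
        (1 + Real.exp 2) ^ n := by
      have : (1 * 1ᵀ + (2 * s * σ ^ 2) • 1 : Matrix (Fin n) (Fin n) ℝ) =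
          (1 + Real.exp 2) • 1 := by
        rw [hτ, add_smul, one_smul, Matrix.transpose_one, one_mul]
      rw [this, Matrix.det_smul, Matrix.det_one, mul_one, Fintype.card_fin]
    rw [hdet, hsR, Matrix.transpose_one, one_mul, Matrix.det_one]
    calc Real.exp (n / 2) * √(1 / (1 + Real.exp 2) ^ n)
        ≤ Real.exp (n / 2) * √(Real.exp (-n) ^ 2) := by
          gcongr
          rw [← Real.exp_nat_mul, div_le_iff₀ (by positivity)]
          calc (1 : ℝ) = Real.exp (((2 : ℕ) : ℝ) * -n) * Real.exp 2 ^ n := by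
                rw [← Real.exp_nat_mul, ← Real.exp_add, ← Real.exp_zero]
                congr 1
                push_cast
                ring
            _ ≤ _ := by
                gcongr
                linarith
      _ = Real.exp (-(n / 2)) := by
          rw [Real.sqrt_sq (Real.exp_pos _).le, ← Real.exp_add]
          congr 1
          ring

end SmallBall

/-! ## Exponential moments of the features -/

section Moments

variable {p d : ℕ} {ν : Measure (E p)} {a : E p → E d}

theorem inner_sq_eq_quadratic (u v : E d) :
    inner ℝ u v ^ 2 = u.ofLp ⬝ᵥ (Matrix.vecMulVec v.ofLp v.ofLp).mulVec u.ofLp := by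
  have h : inner ℝ u v = u.ofLp ⬝ᵥ v.ofLp := by
    simp [PiLp.inner_apply, dotProduct, mul_comm]
  rw [h, Matrix.vecMulVec_mulVec, dotProduct_comm v.ofLp]
  simp [sq]

theorem IsWhitened.integrable_inner_sq (h : IsWhitened ν a) (ha : Measurable a) (v : E d) :
    Integrable (fun x => inner ℝ (a x) v ^ 2) ν := by
  simp only [inner_sq_eq_quadratic]
  exact h.integrable_quadratic ha _

theorem IsWhitened.integral_inner_sq (h : IsWhitened ν a) (ha : Measurable a) (v : E d) :
    ∫ x, inner ℝ (a x) v ^ 2 ∂ν = ‖v‖ ^ 2 := by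
  simp only [inner_sq_eq_quadratic]
  rw [h.integral_quadratic ha, Matrix.trace_vecMulVec, dotProduct_self_eq_norm_sq]

theorem lintegral_pow_le_of_isSubGaussianVar {Ω : Type*} [MeasurableSpace Ω] {P : Measure Ω}
    {K : ℝ} (hK : 0 < K) {Z : Ω → ℝ} (hZ : IsSubGaussianVar P K Z) {k : ℕ} (hk : 0 < k) :
    ∫⁻ x, ENNReal.ofReal (Z x ^ (2 * k)) ∂P ≤ ENNReal.ofReal ((2 * k * K ^ 2) ^ k) := by
  have hk' : (1 : ℝ) ≤ k := by exact_mod_cast hk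
  have h := hZ (2 * k : ℕ) (by push_cast; linarith)
  have heq : ∫⁻ x, ENNReal.ofReal (Z x ^ (2 * k)) ∂P =
      eLpNorm Z (ENNReal.ofReal (2 * k : ℕ)) P ^ (2 * k) := by
    have h2 := eLpNorm_nnreal_pow_eq_lintegral (f := Z) (μ := P)
      (p := ((2 * k : ℕ) : NNReal)) (by positivity)
    rw [NNReal.coe_natCast, ENNReal.rpow_natCast, ENNReal.coe_natCast] at h2
    rw [ENNReal.ofReal_natCast, h2]
    refine lintegral_congr fun x => ?_
    rw [ENNReal.rpow_natCast, Real.enorm_eq_ofReal_abs, ← ENNReal.ofReal_pow (abs_nonneg _),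
      (even_two_mul k).pow_abs]
  rw [heq]
  refine (pow_le_pow_left' h (2 * k)).trans_eq ?_
  rw [← ENNReal.ofReal_pow (by positivity)]
  congr 1
  rw [pow_mul, mul_pow, Real.sq_sqrt (by positivity)]
  push_cast
  ring

/-- In the power series of the exponential, the moment bound and `k ^ k / k! ≤ e ^ k` bound the
`k`-th term by `(2 c e K²) ^ k`. The constant makes this `2⁻¹ ^ k`, summing to `2`. -/
theorem lintegral_exp_sq_le_of_isSubGaussianVar {Ω : Type*} [MeasurableSpace Ω] {P : Measure Ω}
    [IsProbabilityMeasure P] {K : ℝ} (hK : 0 < K) {Z : Ω → ℝ} (hZm : Measurable Z)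
    (hZ : IsSubGaussianVar P K Z) :
    ∫⁻ x, ENNReal.ofReal (Real.exp ((4 * Real.exp 1 * K ^ 2)⁻¹ * Z x ^ 2)) ∂P ≤ 2 := by
  set c := (4 * Real.exp 1 * K ^ 2)⁻¹ with hc
  have hc0 : 0 < c := by positivity
  have hexp : ∀ x, ENNReal.ofReal (Real.exp (c * Z x ^ 2)) =
      ∑' k : ℕ, ENNReal.ofReal (c ^ k / k.factorial) * ENNReal.ofReal (Z x ^ (2 * k)) := fun x => by
    have hsum := NormedSpace.expSeries_div_hasSum_exp (c * Z x ^ 2)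
    rw [← Real.exp_eq_exp_ℝ] at hsum
    rw [← hsum.tsum_eq, ENNReal.ofReal_tsum_of_nonneg (fun k => by positivity) hsum.summable]
    refine tsum_congr fun k => ?_
    rw [← ENNReal.ofReal_mul (by positivity), mul_pow, pow_mul]
    congr 1
    ring
  simp only [hexp]
  rw [lintegral_tsum fun k => by fun_prop, ← ENNReal.tsum_geometric_two]
  refine ENNReal.tsum_le_tsum fun k => ?_
  rw [lintegral_const_mul _ (by fun_prop)]
  rcases Nat.eq_zero_or_pos k with rfl | hk
  · simp
  · refine (mul_le_mul_right (lintegral_pow_le_of_isSubGaussianVar hK hZ hk) _).trans ?_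
    have h2 : (2⁻¹ : ENNReal) ^ k = ENNReal.ofReal (2⁻¹ ^ k) := by
      rw [ENNReal.ofReal_pow (by norm_num), ENNReal.ofReal_inv_of_pos (by norm_num)]
      norm_num
    rw [h2, ← ENNReal.ofReal_mul (by positivity)]
    refine ENNReal.ofReal_le_ofReal ?_
    have h3 := Real.pow_div_factorial_le_exp (k : ℝ) k.cast_nonneg k
    have h4 : Real.exp k = Real.exp 1 ^ k := by
      rw [← Real.exp_nat_mul, mul_one]
    calc c ^ k / k.factorial * (2 * k * K ^ 2) ^ k
        = (2 * c * K ^ 2) ^ k * ((k : ℝ) ^ k / k.factorial) := by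
          rw [mul_pow, mul_pow, mul_pow, mul_pow]
          ring
      _ ≤ (2 * c * K ^ 2) ^ k * Real.exp 1 ^ k := by
          rw [← h4]
          gcongr
      _ = 2⁻¹ ^ k := by
          rw [← mul_pow, hc]
          congr 1
          field_simp
          norm_num

/-- The exact value is `√2`. -/
theorem lintegral_exp_sq_gaussianReal_le :
    ∫⁻ z, ENNReal.ofReal (Real.exp (4⁻¹ * z ^ 2)) ∂(gaussianReal 0 1) ≤ 2 := by
  rw [gaussianReal_of_var_ne_zero _ one_ne_zero, lintegral_withDensity_eq_lintegral_mul _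
    (measurable_gaussianPDF _ _) (by fun_prop)]
  have heq : ∀ z, (gaussianPDF 0 1 * fun z => ENNReal.ofReal (Real.exp (4⁻¹ * z ^ 2))) z =
      ENNReal.ofReal ((√(2 * Real.pi))⁻¹ * Real.exp (-(4⁻¹ : ℝ) * z ^ 2)) := fun z => by
    rw [Pi.mul_apply, gaussianPDF, gaussianPDFReal, ← ENNReal.ofReal_mul (by positivity), mul_assoc,
      ← Real.exp_add]
    simp only [NNReal.coe_one, mul_one, sub_zero]
    congr 3
    ring
  simp only [heq]
  rw [← ofReal_integral_eq_lintegral_ofReal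
    ((integrable_exp_neg_mul_sq (by norm_num : (0 : ℝ) < 4⁻¹)).const_mul _)
    (ae_of_all _ fun z => by positivity), integral_const_mul, integral_gaussian]
  have h1 : √(Real.pi / 4⁻¹) = √2 * √(2 * Real.pi) := by
    rw [← Real.sqrt_mul (by norm_num)]
    congr 1
    ring
  have h2 : (0 : ℝ) < √(2 * Real.pi) := by positivity
  rw [h1, mul_comm, mul_assoc, mul_inv_cancel₀ h2.ne', mul_one]
  refine (ENNReal.ofReal_le_ofReal (Real.sqrt_le_iff.2 ⟨by norm_num, ?_⟩ : √2 ≤ 2)).trans_eq ?_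
  · norm_num
  · norm_num

theorem IsGaussianFeature.map_inner_eq (hG : IsGaussianFeature ν a) (h : IsWhitened ν a)
    (ha : Measurable a) {v : E d} (hv : ‖v‖ = 1) :
    ν.map (fun x => inner ℝ (a x) v) = gaussianReal 0 1 := by
  have hsum : ∀ x, inner ℝ (a x) v = ∑ j, v j * a x j := fun x => by
    simp [PiLp.inner_apply]
  have hcoord : ∀ j, HasGaussianLaw (fun x => a x j) ν := fun j =>
    ⟨by rw [hG.2 j]; infer_instance⟩
  have hlaw : HasGaussianLaw (fun x => inner ℝ (a x) v) ν := by
    simp only [hsum]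
    exact iIndepFun.hasGaussianLaw_fun_sum (fun j => (hcoord j).fun_smul (v j))
      (hG.1.comp (fun j t => v j * t) fun j => by fun_prop)
  have hmean : ∫ x, inner ℝ (a x) v ∂ν = 0 := by
    simp only [hsum]
    rw [integral_finsetSum _ fun j _ => (hcoord j).integrable.const_mul (v j)]
    refine Finset.sum_eq_zero fun j _ => ?_
    have hid : ∫ x, a x j ∂ν = ∫ t, t ∂(ν.map fun x => a x j) :=
      (integral_map (hcoord j).aemeasurable aestronglyMeasurable_id).symm
    rw [integral_const_mul, hid, hG.2 j, integral_id_gaussianReal, mul_zero]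
  rw [hlaw.map_eq_gaussianReal, hmean, variance_of_integral_eq_zero (by fun_prop) hmean,
    h.integral_inner_sq ha, hv]
  simp

/-- A uniform exponential moment of the squared marginals of the features. -/
theorem exists_lintegral_exp_inner_sq_le {K : ℝ} (hK : 0 < K) :
    ∃ c : ℝ, 0 < c ∧ ∀ (d p : ℕ) (ν : Measure (E p)) (a : E p → E d), IsProbabilityMeasure ν →
      Measurable a → IsWhitened ν a → (IsGaussianFeature ν a ∨ IsSubGaussianFeature ν K a) →
      ∀ v : E d, ‖v‖ ≤ 1 → ∫⁻ x, ENNReal.ofReal (Real.exp (c * inner ℝ (a x) v ^ 2)) ∂ν ≤ 2 := by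
  -- The first constant serves Gaussian features, the second sub-Gaussian ones.
  refine ⟨min 4⁻¹ (4 * Real.exp 1 * K ^ 2)⁻¹, by positivity, ?_⟩
  intro d p ν a _ ha hw hfeat v hv
  set c := min 4⁻¹ (4 * Real.exp 1 * K ^ 2)⁻¹ with hc
  by_cases hv0 : v = 0
  · simp [hv0]
  have hvpos : 0 < ‖v‖ := norm_pos_iff.2 hv0
  have hunit : ∀ x, inner ℝ (a x) v ^ 2 ≤ (inner ℝ (a x) v / ‖v‖) ^ 2 := fun x => by
    rw [div_pow, le_div_iff₀ (by positivity)]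
    exact mul_le_of_le_one_right (sq_nonneg _) (pow_le_one₀ hvpos.le hv)
  have hmono : ∀ c', c ≤ c' → ∫⁻ x, ENNReal.ofReal (Real.exp (c * inner ℝ (a x) v ^ 2)) ∂ν ≤
      ∫⁻ x, ENNReal.ofReal (Real.exp (c' * (inner ℝ (a x) v / ‖v‖) ^ 2)) ∂ν := fun c' hcc' => by
    refine lintegral_mono fun x => ENNReal.ofReal_le_ofReal (Real.exp_le_exp.2 ?_)
    have : 0 ≤ c := by positivity
    exact mul_le_mul hcc' (hunit x) (sq_nonneg _) (this.trans hcc')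
  rcases hfeat with hG | hS
  · refine (hmono _ (min_le_left _ _)).trans ?_
    have hnorm : ‖(‖v‖⁻¹ • v)‖ = 1 := by
      rw [norm_smul, norm_inv, norm_norm, inv_mul_cancel₀ hvpos.ne']
    have hmap := hG.map_inner_eq hw ha hnorm
    have heq : ∀ x, inner ℝ (a x) v / ‖v‖ = inner ℝ (a x) (‖v‖⁻¹ • v) := fun x => by
      rw [inner_smul_right, div_eq_inv_mul]
    simp only [heq]
    refine le_trans (le_of_eq ?_) lintegral_exp_sq_gaussianReal_le
    rw [← hmap, lintegral_map (by fun_prop) (by fun_prop)]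
  · refine (hmono _ (min_le_right _ _)).trans ?_
    exact lintegral_exp_sq_le_of_isSubGaussianVar hK (by fun_prop) (hS v hv0)

end Moments

/-! ## Sparse singular values of the design matrix -/

section SparseNorm

variable {n d p : ℕ} {ν : Measure (E p)} {a : E p → E d}

/-- `A` as a linear map. -/
def applyLin (A : Matrix (Fin n) (Fin d) ℝ) : E d →ₗ[ℝ] E n where
  toFun := apply A
  map_add' α β := by
    ext i
    simp [apply, Matrix.mulVec_add]
  map_smul' c α := by
    ext i
    simp [apply, Matrix.mulVec_smul]

theorem norm_sq_apply_trainMatrix (a : E p → E d) (x : Fin n → E p) (α : E d) :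
    ‖apply (trainMatrix a x) α‖ ^ 2 = ∑ i, inner ℝ (a (x i)) α ^ 2 := by
  rw [EuclideanSpace.real_norm_sq_eq]
  refine Finset.sum_congr rfl fun i _ => ?_
  congr 1
  simp [apply, trainMatrix, Matrix.mulVec, dotProduct, PiLp.inner_apply, mul_comm]

/-- The squared norm is a sum over independent rows, so the exponential moment is a product of `n`
factors at most `2`. -/
theorem lintegral_exp_norm_sq_apply_le [IsProbabilityMeasure ν] (ha : Measurable a) {c : ℝ}
    {v : E d} (hv : ∫⁻ x, ENNReal.ofReal (Real.exp (c * inner ℝ (a x) v ^ 2)) ∂ν ≤ 2) :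
    ∫⁻ x, ENNReal.ofReal (Real.exp (c * ‖apply (trainMatrix a x) v‖ ^ 2))
      ∂(Measure.pi fun _ : Fin n => ν) ≤ 2 ^ n := by
  have hm : Measurable fun x => ENNReal.ofReal (Real.exp (c * inner ℝ (a x) v ^ 2)) := by
    fun_prop
  have heq : ∀ x : Fin n → E p,
      ENNReal.ofReal (Real.exp (c * ‖apply (trainMatrix a x) v‖ ^ 2)) =
      ∏ i, ENNReal.ofReal (Real.exp (c * inner ℝ (a (x i)) v ^ 2)) := fun x => by
    rw [norm_sq_apply_trainMatrix, Finset.mul_sum, Real.exp_sum,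
      ENNReal.ofReal_prod_of_nonneg fun i _ => (Real.exp_pos _).le]
  simp only [heq]
  rw [lintegral_prod_eq_prod_lintegral_of_indepFun Finset.univ
    (fun (i : Fin n) (x : Fin n → E p) => ENNReal.ofReal (Real.exp (c * inner ℝ (a (x i)) v ^ 2)))
    (iIndepFun_pi fun i => hm.aemeasurable) fun i => hm.comp (measurable_pi_apply i)]
  refine (Finset.prod_le_pow_card _ _ 2 fun i _ => ?_).trans_eq (by simp)
  rw [(measurePreserving_eval (fun _ : Fin n => ν) i).lintegral_comp hm]
  exact hv

/-- The largest value of a convex exponential on the unit ball is controlled by its average over a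
larger ball. -/
theorem volume_ball_mul_exp_le {V W : Type*} [NormedAddCommGroup V] [InnerProductSpace ℝ V]
    [FiniteDimensional ℝ V] [MeasurableSpace V] [BorelSpace V] [NormedAddCommGroup W]
    [InnerProductSpace ℝ W] [MeasurableSpace W] [BorelSpace W] (B : V →ₗ[ℝ] W) {c : ℝ}
    (hc : 0 ≤ c) {v : V} (hv : ‖v‖ ≤ 1) :
    volume (Metric.ball (0 : V) 1) * ENNReal.ofReal (Real.exp (c * ‖B v‖ ^ 2)) ≤
      ∫⁻ u in Metric.ball (0 : V) 2, ENNReal.ofReal (Real.exp (c * ‖B u‖ ^ 2)) := by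
  set F : V → ENNReal := fun u => ENNReal.ofReal (Real.exp (c * ‖B u‖ ^ 2)) with hF
  have hFm : Measurable F := by
    have : Measurable B := B.continuous_of_finiteDimensional.measurable
    fun_prop
  set g := (Metric.ball v 1).indicator F with hg
  have hgm : Measurable g := hFm.indicator Metric.isOpen_ball.measurableSet
  -- The parallelogram law and convexity of `exp` give `2 F(v) ≤ F(v + u) + F(v - u)`. Integrated
  -- over `u` in the unit ball, both terms become the integral of `F` over the ball around `v`,
  -- inside the ball of radius `2`.
  have hpt : ∀ u, (Metric.ball (0 : V) 1).indicator (fun _ => 2 * F v) u ≤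
      g (v + u) + g (v - u) := fun u => by
    by_cases hu : u ∈ Metric.ball (0 : V) 1
    · have hu' : ‖u‖ < 1 := by simpa using hu
      have h1 : v + u ∈ Metric.ball v 1 := by simpa using hu'
      have h2 : v - u ∈ Metric.ball v 1 := by simpa [dist_eq_norm] using hu'
      rw [Set.indicator_of_mem hu, hg, Set.indicator_of_mem h1, Set.indicator_of_mem h2]
      simp only [hF]
      rw [← ENNReal.ofReal_add (Real.exp_pos _).le (Real.exp_pos _).le, ← ENNReal.ofReal_ofNat,
        ← ENNReal.ofReal_mul (by norm_num)]
      refine ENNReal.ofReal_le_ofReal ?_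
      have hpar : ‖B (v + u)‖ ^ 2 + ‖B (v - u)‖ ^ 2 = 2 * (‖B v‖ ^ 2 + ‖B u‖ ^ 2) := by
        rw [map_add, map_sub]
        simpa [sq] using parallelogram_law_with_norm ℝ (B v) (B u)
      have hconv := convexOn_exp.2 (Set.mem_univ (c * ‖B (v + u)‖ ^ 2))
        (Set.mem_univ (c * ‖B (v - u)‖ ^ 2)) (by norm_num : (0 : ℝ) ≤ 1 / 2)
        (by norm_num : (0 : ℝ) ≤ 1 / 2) (by norm_num)
      simp only [smul_eq_mul] at hconv
      have hle : Real.exp (c * ‖B v‖ ^ 2) ≤ Real.exp (1 / 2 * (c * ‖B (v + u)‖ ^ 2) +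
          1 / 2 * (c * ‖B (v - u)‖ ^ 2)) := by
        refine Real.exp_le_exp.2 ?_
        nlinarith [mul_nonneg hc (sq_nonneg ‖B u‖)]
      linarith
    · rw [Set.indicator_of_notMem hu]
      exact zero_le
  have hint := lintegral_mono (μ := volume) hpt
  rw [lintegral_indicator_const Metric.isOpen_ball.measurableSet,
    lintegral_add_left (by fun_prop), lintegral_add_left_eq_self g v,
    lintegral_sub_left_eq_self g v, ← two_mul, mul_assoc,
    ENNReal.mul_le_mul_iff_right (by norm_num) (by norm_num), mul_comm, hg,
    lintegral_indicator Metric.isOpen_ball.measurableSet] at hint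
  refine hint.trans (lintegral_mono_set ?_)
  refine Metric.ball_subset_ball' ?_
  rw [dist_zero_right]
  linarith

/-- Averaging over a ball replaces a net: the supremum over the unit ball of `V` is controlled by
`Φ`, whose mean follows from Tonelli. The `4 ^ n` is `2 ^ n` from the row moments times `2 ^ n` from
the volume ratio. The exponent `c / 4` compensates for vectors of norm up to `2`. -/
theorem pi_exists_lt_norm_sq_apply_le [IsProbabilityMeasure ν] (ha : Measurable a) {c : ℝ}
    (hc : 0 < c)
    (hexp : ∀ v : E d, ‖v‖ ≤ 1 →
      ∫⁻ x, ENNReal.ofReal (Real.exp (c * inner ℝ (a x) v ^ 2)) ∂ν ≤ 2)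
    (V : Submodule ℝ (E d)) (hV : Module.finrank ℝ V ≤ n) (t : ℝ) :
    (Measure.pi fun _ : Fin n => ν)
        {x | ∃ v ∈ V, t * ‖v‖ ^ 2 < ‖apply (trainMatrix a x) v‖ ^ 2} ≤
      ENNReal.ofReal (4 ^ n * Real.exp (-(c / 4 * t))) := by
  set Φ : (Fin n → E p) → ENNReal := fun x => ∫⁻ u in Metric.ball (0 : V) 2,
    ENNReal.ofReal (Real.exp (c / 4 * ‖apply (trainMatrix a x) (u : E d)‖ ^ 2)) with hΦ
  have hm : Measurable fun q : (Fin n → E p) × V =>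
      ENNReal.ofReal (Real.exp (c / 4 * ‖apply (trainMatrix a q.1) (q.2 : E d)‖ ^ 2)) := by
    simp only [norm_sq_apply_trainMatrix]
    fun_prop
  have hΦm : Measurable Φ := hm.lintegral_prod_right'
  set b := volume (Metric.ball (0 : V) 1) with hb
  have hb0 : b ≠ 0 := (Metric.measure_ball_pos volume (0 : V) one_pos).ne'
  have hbtop : b ≠ ⊤ := measure_ball_lt_top.ne
  have hsub : {x | ∃ v ∈ V, t * ‖v‖ ^ 2 < ‖apply (trainMatrix a x) v‖ ^ 2} ⊆
      {x | b * ENNReal.ofReal (Real.exp (c / 4 * t)) ≤ Φ x} := by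
    rintro x ⟨v, hvV, hv⟩
    have hv0 : 0 < ‖v‖ := by
      rw [norm_pos_iff]
      rintro rfl
      have : apply (trainMatrix a x) (0 : E d) = 0 := (applyLin (trainMatrix a x)).map_zero
      simp [this] at hv
    set v' : V := ‖v‖⁻¹ • ⟨v, hvV⟩ with hv'
    have hnorm : ‖v'‖ ≤ 1 := by
      rw [hv', norm_smul, norm_inv, norm_norm]
      exact (inv_mul_cancel₀ hv0.ne').le
    refine le_trans ?_ (volume_ball_mul_exp_le ((applyLin (trainMatrix a x)).comp V.subtype)
      (by positivity : 0 ≤ c / 4) hnorm)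
    refine mul_le_mul_right (ENNReal.ofReal_le_ofReal (Real.exp_le_exp.2 ?_)) _
    refine mul_le_mul_of_nonneg_left ?_ (by positivity)
    rw [hv', map_smul, norm_smul, norm_inv, norm_norm, mul_pow, inv_pow, ← div_eq_inv_mul,
      le_div_iff₀ (by positivity)]
    exact hv.le
  have hΦint : ∫⁻ x, Φ x ∂(Measure.pi fun _ : Fin n => ν) ≤ 4 ^ n * b := by
    rw [hΦ, lintegral_lintegral_swap hm.aemeasurable]
    have hinner : ∀ u ∈ Metric.ball (0 : V) 2,
        ∫⁻ x, ENNReal.ofReal (Real.exp (c / 4 * ‖apply (trainMatrix a x) (u : E d)‖ ^ 2))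
          ∂(Measure.pi fun _ : Fin n => ν) ≤ 2 ^ n := fun u hu => by
      have hu' : ‖u‖ < 2 := by simpa using hu
      have hhalf : ‖(2⁻¹ : ℝ) • (u : E d)‖ ≤ 1 := by
        rw [norm_smul, norm_inv, Real.norm_two, ← Submodule.coe_norm]
        linarith
      refine le_trans (le_of_eq ?_) (lintegral_exp_norm_sq_apply_le ha (hexp _ hhalf))
      refine lintegral_congr fun x => ?_
      have : apply (trainMatrix a x) ((2⁻¹ : ℝ) • (u : E d)) =
          (2⁻¹ : ℝ) • apply (trainMatrix a x) (u : E d) := (applyLin _).map_smul _ _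
      rw [this, norm_smul, mul_pow]
      congr 2
      norm_num
      ring
    refine (setLIntegral_mono measurable_const hinner).trans ?_
    rw [setLIntegral_const]
    have hball : volume (Metric.ball (0 : V) 2) = ENNReal.ofReal (2 ^ Module.finrank ℝ V) * b := by
      have := Measure.addHaar_ball_mul_of_pos (volume : Measure V) 0 two_pos 1
      rwa [mul_one] at this
    rw [hball, ← mul_assoc, ENNReal.ofReal_pow (by norm_num), ENNReal.ofReal_ofNat]
    refine mul_le_mul_left ?_ _
    calc (2 : ENNReal) ^ n * 2 ^ Module.finrank ℝ V ≤ 2 ^ n * 2 ^ n := by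
          gcongr
          norm_num
      _ = 4 ^ n := by
          rw [← mul_pow]
          norm_num
  refine (measure_mono hsub).trans ((meas_ge_le_lintegral_div hΦm.aemeasurable
    (mul_ne_zero hb0 (by simp [Real.exp_pos])) (ENNReal.mul_ne_top hbtop ENNReal.ofReal_ne_top)).trans ?_)
  refine ENNReal.div_le_of_le_mul (hΦint.trans_eq ?_)
  rw [mul_comm b, ← mul_assoc, ← ENNReal.ofReal_mul (by positivity), mul_assoc (4 ^ n : ℝ),
    ← Real.exp_add, neg_add_cancel, Real.exp_zero, mul_one, ENNReal.ofReal_pow (by norm_num),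
    ENNReal.ofReal_ofNat]

theorem apply_one (α : E d) : apply (1 : Matrix (Fin d) (Fin d) ℝ) α = α := by
  simp [apply]

/-- With high probability, all restrictions of the design matrix to `n` columns have operator norm
of order `√(n log (d / n))`. -/
theorem pi_exists_sparse_lt_norm_sq_apply_le [IsProbabilityMeasure ν] (ha : Measurable a) {c : ℝ}
    (hc : 0 < c)
    (hexp : ∀ v : E d, ‖v‖ ≤ 1 →
      ∫⁻ x, ENNReal.ofReal (Real.exp (c * inner ℝ (a x) v ^ 2)) ∂ν ≤ 2)
    (hn : 0 < n) (hnd : 2 * n ≤ d) :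
    (Measure.pi fun _ : Fin n => ν)
        {x | ∃ v : E d, (support v).card = n ∧
          28 * n * Real.log ((d : ℝ) / n) / c * ‖v‖ ^ 2 < ‖apply (trainMatrix a x) v‖ ^ 2} ≤
      ENNReal.ofReal (Real.exp (-(n * Real.log ((d : ℝ) / n)))) := by
  have hn' : (0 : ℝ) < n := by exact_mod_cast hn
  have hnd' : 2 * (n : ℝ) ≤ d := by exact_mod_cast hnd
  have hratio : 2 ≤ (d : ℝ) / n := by rwa [le_div_iff₀ hn']
  set L := Real.log ((d : ℝ) / n) with hL
  have hL2 : Real.log 2 ≤ L := Real.log_le_log two_pos hratio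
  have hlog2 := Real.log_two_gt_d9
  -- Now `c / 4 * t = 7 n L`. The supports cost `n L + n` and `4 ^ n` costs at most `2 n`, so the
  -- exponent is at most `-n L` once `3 ≤ 5 L`, which `L ≥ log 2` ensures.
  set t := 28 * n * L / c with ht
  set V : Finset (Fin d) → Submodule ℝ (E d) := fun S =>
    Submodule.span ℝ (column (1 : Matrix (Fin d) (Fin d) ℝ) '' (S : Set (Fin d))) with hV
  have hsub : {x : Fin n → E p | ∃ v : E d, (support v).card = n ∧
        t * ‖v‖ ^ 2 < ‖apply (trainMatrix a x) v‖ ^ 2} ⊆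
      ⋃ S ∈ (Finset.univ : Finset (Fin d)).powersetCard n,
        {x | ∃ v ∈ V S, t * ‖v‖ ^ 2 < ‖apply (trainMatrix a x) v‖ ^ 2} := by
    rintro x ⟨v, hv, hlt⟩
    simp only [Set.mem_iUnion]
    refine ⟨support v, Finset.mem_powersetCard.2 ⟨Finset.subset_univ _, hv⟩, v, ?_, hlt⟩
    have := apply_mem_span (A := (1 : Matrix (Fin d) (Fin d) ℝ)) (Finset.Subset.refl (support v))
    rwa [apply_one] at this
  have hrank : ∀ S ∈ (Finset.univ : Finset (Fin d)).powersetCard n,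
      Module.finrank ℝ (V S) ≤ n := fun S hS => by
    classical
    have h1 := finrank_span_finset_le_card (R := ℝ)
      (S.image (column (1 : Matrix (Fin d) (Fin d) ℝ)))
    rw [Set.finrank, Finset.coe_image] at h1
    exact h1.trans (Finset.card_image_le.trans (Finset.mem_powersetCard.1 hS).2.le)
  refine (measure_mono hsub).trans ((measure_biUnion_finset_le _ _).trans
    ((Finset.sum_le_card_nsmul _ _ _ fun S hS =>
      pi_exists_lt_norm_sq_apply_le ha hc hexp (V S) (hrank S hS) t).trans ?_))
  rw [Finset.card_powersetCard, Finset.card_univ, Fintype.card_fin, nsmul_eq_mul,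
    ← ENNReal.ofReal_natCast, ← ENNReal.ofReal_mul (by positivity)]
  refine ENNReal.ofReal_le_ofReal ?_
  have hchoose : (d.choose n : ℝ) ≤ Real.exp (n * L + n) := by
    have h1 : (d.choose n : ℝ) ≤ (d : ℝ) ^ n / n.factorial := Nat.choose_le_pow_div n d
    have h2 := Real.pow_div_factorial_le_exp (n : ℝ) hn'.le n
    have h3 : (d : ℝ) = n * Real.exp L := by
      rw [hL, Real.exp_log (by positivity)]
      field_simp
    calc (d.choose n : ℝ) ≤ (d : ℝ) ^ n / n.factorial := h1
      _ = Real.exp L ^ n * ((n : ℝ) ^ n / n.factorial) := by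
          rw [h3, mul_pow]
          ring
      _ ≤ Real.exp L ^ n * Real.exp n := by gcongr
      _ = _ := by rw [← Real.exp_nat_mul, Real.exp_add]
  have hfour : (4 : ℝ) ^ n ≤ Real.exp (2 * n) := by
    have h1 : (4 : ℝ) ≤ Real.exp 2 := by
      have h2 := Real.add_one_le_exp (1 : ℝ)
      have h3 : Real.exp 2 = Real.exp 1 * Real.exp 1 := by
        rw [← Real.exp_add]
        norm_num
      nlinarith
    calc (4 : ℝ) ^ n ≤ Real.exp 2 ^ n := by gcongr
      _ = _ := by rw [← Real.exp_nat_mul, mul_comm]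
  have htc : c / 4 * t = 7 * n * L := by
    rw [ht]
    field_simp
    ring
  calc (d.choose n : ℝ) * (4 ^ n * Real.exp (-(c / 4 * t)))
      ≤ Real.exp (n * L + n) * (Real.exp (2 * n) * Real.exp (-(7 * n * L))) := by
        rw [htc]
        gcongr
    _ = Real.exp (n * L + n + (2 * n + -(7 * n * L))) := by rw [Real.exp_add (n * L + n), Real.exp_add (2 * (n : ℝ))]
    _ ≤ Real.exp (-(n * L)) := by
        refine Real.exp_le_exp.2 ?_
        nlinarith

end SparseNorm

/-! ## The noisy linear model -/

section Model

variable {n d p : ℕ} {ν : Measure (E p)} {a : E p → E d}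

/-- A basis of the column space can be chosen among the columns. This is how data avoiding all small
spans will force full row rank. -/
theorem exists_finset_span_column_eq (A : Matrix (Fin n) (Fin d) ℝ) :
    ∃ S : Finset (Fin d), S.card ≤ A.rank ∧
      Submodule.span ℝ (column A '' (S : Set (Fin d))) =
        Submodule.span ℝ (Set.range (column A)) := by
  classical
  obtain ⟨f, hf, hspan, -⟩ :=
    Submodule.exists_fun_fin_finrank_span_eq ℝ (Set.range (column A))
  choose g hg using hf
  refine ⟨Finset.univ.image g, ?_, ?_⟩
  · rw [rank_eq_finrank_span_column]
    exact Finset.card_image_le.trans (by simp)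
  · refine Eq.trans ?_ hspan
    rw [Finset.coe_image, Finset.coe_univ, Set.image_univ, ← Set.range_comp]
    congr 2
    exact funext hg

theorem finrank_span_column_le (A : Matrix (Fin n) (Fin d) ℝ) (S : Finset (Fin d)) :
    Module.finrank ℝ (Submodule.span ℝ (column A '' (S : Set (Fin d)))) ≤ S.card := by
  classical
  have h := finrank_span_finset_le_card (R := ℝ) (S.image (column A))
  rw [Set.finrank, Finset.coe_image] at h
  exact h.trans Finset.card_image_le

theorem pi_noiseLaw_translate_mem_eq_zero {σ : ℝ} (hσ : 0 < σ) {V : Submodule ℝ (E n)}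
    (hV : V ≠ ⊤) (b : Fin n → ℝ) :
    (Measure.pi fun _ : Fin n => noiseLaw σ) {w | WithLp.toLp 2 (b + w) ∈ V} = 0 := by
  refine pi_noiseLaw_absolutelyContinuous n hσ ?_
  set V' := V.comap ((WithLp.linearEquiv 2 ℝ (Fin n → ℝ)).symm : (Fin n → ℝ) →ₗ[ℝ] E n) with hV'
  have hne : V' ≠ ⊤ := fun h => hV <| by
    rw [eq_top_iff]
    intro v _
    have : v.ofLp ∈ V' := h ▸ Submodule.mem_top
    exact this
  have heq : {w | WithLp.toLp 2 (b + w) ∈ V} = (fun w => b + w) ⁻¹' (V' : Set (Fin n → ℝ)) := rfl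
  rw [heq, measure_preimage_add]
  exact Measure.addHaar_submodule volume _ hne

theorem ae_trainOutput_notMem_span [IsProbabilityMeasure ν] (ha : Measurable a) {σ : ℝ}
    (hσ : 0 < σ) (αstar : E d) {S : Finset (Fin d)} (hS : S.card < n) :
    ∀ᵐ z ∂(trainLaw n ν σ), trainOutput a αstar z.1 z.2 ∉
      Submodule.span ℝ (column (trainMatrix a z.1) '' (S : Set (Fin d))) := by
  -- Membership in the span is exhausted by countably many events with coefficients in a compact
  -- set; these are measurable, so nullity can be checked for each fixed `x`.
  set K : ℕ → Set (E d) := fun N => Metric.closedBall 0 N ∩ {α | ∀ j ∉ S, α j = 0} with hK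
  have hKc : ∀ N, IsCompact (K N) := fun N => by
    refine (isCompact_closedBall _ _).inter_right ?_
    simp only [Set.ofPred_forall]
    exact isClosed_iInter fun j => isClosed_iInter fun _ => isClosed_eq (by fun_prop) (by fun_prop)
  set D : ℕ → Set ((Fin n → E p) × (Fin n → ℝ)) := fun N =>
    {z | ∃ α ∈ K N, apply (trainMatrix a z.1) α = trainOutput a αstar z.1 z.2} with hD
  have hnull : ∀ N, trainLaw n ν σ (D N) = 0 := fun N => by
    rw [trainLaw, Measure.measure_prod_null (measurableSet_exists_apply_eq ha αstar (hKc N))]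
    refine ae_of_all _ fun x => ?_
    have hV : Submodule.span ℝ (column (trainMatrix a x) '' (S : Set (Fin d))) ≠ ⊤ := fun h => by
      have h1 := finrank_span_column_le (trainMatrix a x) S
      rw [h, finrank_top, finrank_euclideanSpace_fin] at h1
      omega
    refine measure_mono_null ?_ (pi_noiseLaw_translate_mem_eq_zero hσ hV
      fun i => inner ℝ (a (x i)) αstar)
    rintro w ⟨α, hα, hw⟩
    have hsupp : support α ⊆ S := fun j hj => by
      by_contra hjS
      exact mem_support.1 hj (hα.2 j hjS)
    have := apply_mem_span (A := trainMatrix a x) hsupp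
    rw [hw] at this
    exact this
  refine measure_mono_null ?_ (measure_iUnion_null hnull)
  intro z hz
  obtain ⟨α, hα, hy⟩ := exists_apply_eq_of_mem_span (not_not.1 hz)
  obtain ⟨N, hN⟩ := exists_nat_ge ‖α‖
  refine Set.mem_iUnion.2 ⟨N, α, ⟨mem_closedBall_zero_iff.2 hN, fun j hj => ?_⟩, hy⟩
  by_contra h
  exact hj (hα (mem_support.2 h))

/-- Data outside the span of every set of fewer than `n` columns force orthogonal matching pursuit
to select and use exactly `n` features. -/
theorem IsOMPOutput.card_eq {A : Matrix (Fin n) (Fin d) ℝ} {y : E n}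
    (hy : ∀ S : Finset (Fin d), S.card < n →
      y ∉ Submodule.span ℝ (column A '' (S : Set (Fin d))))
    {S : Finset (Fin d)} {α : E d} (h : IsOMPOutput A y S α) :
    S.card = n ∧ (support α).card = n := by
  have hmem : y ∈ Submodule.span ℝ (column A '' (support α : Set (Fin d))) := by
    have := apply_mem_span (A := A) (Finset.Subset.refl (support α))
    rwa [h.apply_eq] at this
  have hsupp : n ≤ (support α).card := not_lt.1 fun hlt => hy _ hlt hmem
  -- Were the rank smaller, fewer than `n` columns would span the column space, which contains `y`.
  have hrank : A.rank = n := by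
    refine le_antisymm A.rank_le_height (not_lt.1 fun hlt => ?_)
    obtain ⟨T, hT, hspan⟩ := exists_finset_span_column_eq A
    refine hy T (hT.trans_lt hlt) ?_
    rw [hspan]
    exact Submodule.span_mono (Set.image_subset_range _ _) hmem
  obtain ⟨t, ht⟩ := h.1
  have h1 := ht.card_le hrank
  have h2 := Finset.card_le_card h.2.2.1
  omega

theorem ae_isOMPOutput_card_eq [IsProbabilityMeasure ν] (ha : Measurable a) {σ : ℝ} (hσ : 0 < σ)
    (αstar : E d) :
    ∀ᵐ z ∂(trainLaw n ν σ), ∀ (S : Finset (Fin d)) (α : E d),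
      IsOMPOutput (trainMatrix a z.1) (trainOutput a αstar z.1 z.2) S α →
        S.card = n ∧ (support α).card = n := by
  have hae : ∀ᵐ z ∂(trainLaw n ν σ), ∀ S : Finset (Fin d), S.card < n →
      trainOutput a αstar z.1 z.2 ∉
        Submodule.span ℝ (column (trainMatrix a z.1) '' (S : Set (Fin d))) :=
    ae_all_iff.2 fun S => by
      by_cases hS : S.card < n
      · filter_upwards [ae_trainOutput_notMem_span ha hσ αstar hS] with z hz _ using hz
      · exact ae_of_all _ fun z h => absurd h hS
  filter_upwards [hae] with z hz S α h using h.card_eq hz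

/-- Without signal, the test error is the squared norm of the coefficients. -/
theorem testMSE_zero [IsProbabilityMeasure ν] (h : IsWhitened ν a) (ha : Measurable a) (σ : ℝ)
    (α : E d) : testMSE ν σ a 0 α = ‖α‖ ^ 2 := by
  have hw1 : Integrable (fun w : ℝ => w) (noiseLaw σ) :=
    memLp_one_iff_integrable.1 (memLp_id_gaussianReal 1)
  have hw2 : Integrable (fun w : ℝ => w ^ 2) (noiseLaw σ) :=
    (memLp_id_gaussianReal 2).integrable_sq
  have hm1 : ∫ w, w ∂(noiseLaw σ) = 0 := integral_id_gaussianReal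
  have hm2 : ∫ w, w ^ 2 ∂(noiseLaw σ) = σ ^ 2 := by
    have h1 : Var[id; noiseLaw σ] = ((σ ^ 2).toNNReal : ℝ) := variance_id_gaussianReal
    rw [variance_of_integral_eq_zero (X := id) (by fun_prop) hm1, Real.coe_toNNReal _ (sq_nonneg σ)] at h1
    exact h1
  have ha2 := h.integrable_inner_sq ha α
  have ha1 : Integrable (fun x => inner ℝ (a x) α) ν :=
    ((memLp_two_iff_integrable_sq (by fun_prop)).2 ha2).integrable one_le_two
  have hexpand : ∀ z : E p × ℝ, ((inner ℝ (a z.1) 0 + z.2) - inner ℝ (a z.1) α) ^ 2 =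
      z.2 ^ 2 - 2 * (inner ℝ (a z.1) α * z.2) + inner ℝ (a z.1) α ^ 2 := fun z => by
    rw [inner_zero_right]
    ring
  have i1 : Integrable (fun z : E p × ℝ => z.2 ^ 2) (ν.prod (noiseLaw σ)) := hw2.comp_snd ν
  have i2 : Integrable (fun z : E p × ℝ => 2 * (inner ℝ (a z.1) α * z.2))
      (ν.prod (noiseLaw σ)) := (ha1.mul_prod hw1).const_mul 2
  have i3 : Integrable (fun z : E p × ℝ => inner ℝ (a z.1) α ^ 2) (ν.prod (noiseLaw σ)) :=
    ha2.comp_fst (noiseLaw σ)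
  rw [testMSE]
  simp only [hexpand]
  rw [integral_add (f := fun z : E p × ℝ => z.2 ^ 2 - 2 * (inner ℝ (a z.1) α * z.2)) (i1.sub i2) i3,
    integral_sub i1 i2, integral_const_mul,
    integral_prod_mul (fun x => inner ℝ (a x) α) (fun w : ℝ => w), hm1,
    integral_fun_snd (fun w : ℝ => w ^ 2), integral_fun_fst (fun x => inner ℝ (a x) α ^ 2), hm2,
    h.integral_inner_sq ha]
  simp

/-- The lower bound on the test error when there are at most twice as many features as samples. -/
theorem trainLaw_testMSE_lt_le_of_le_two_mul [IsProbabilityMeasure ν] (h : IsWhitened ν a)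
    (ha : Measurable a) (hn : 0 < n) (hnd : n < d) (hd : d ≤ 2 * n) {C σ δ : ℝ}
    (hC : 2 * Real.exp 4 ≤ C) (hσ : 0 < σ) (hδ : 0 < δ) :
    trainLaw n ν σ {z | ∃ (S : Finset (Fin d)) (α : E d),
        IsOMPOutput (trainMatrix a z.1) (trainOutput a 0 z.1 z.2) S α ∧
          ‖α‖ ^ 2 < σ ^ 2 * (1 - δ) / (C * Real.log ((d : ℝ) / n))} ≤
      ENNReal.ofReal (Real.exp (-(n * Real.log ((d : ℝ) / n)))) := by
  obtain ⟨m, rfl⟩ := Nat.exists_eq_add_of_le hnd.le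
  have hm : 0 < m := by omega
  have hmn : m ≤ n := by omega
  have hn' : (0 : ℝ) < n := by exact_mod_cast hn
  have hm' : (0 : ℝ) < m := by exact_mod_cast hm
  have hmn' : (m : ℝ) ≤ n := by exact_mod_cast hmn
  have hratio : ((n + m : ℕ) : ℝ) / n = 1 + m / n := by
    push_cast
    field_simp
  have hpos : (0 : ℝ) < 1 + m / n := by positivity
  set L := Real.log (((n + m : ℕ) : ℝ) / n) with hL
  -- The upper bound on `L` weakens the failure probability `exp (-m)` to `exp (-(n L))`. The lower
  -- bound below, where `m ≤ n` enters, compares the two thresholds.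
  have hLle : n * L ≤ m := by
    have := Real.log_le_sub_one_of_pos hpos
    rw [← hratio, ← hL, hratio, add_sub_cancel_left, le_div_iff₀ hn'] at this
    linarith
  have hLge : m / (2 * n) ≤ L := by
    have := Real.one_sub_inv_le_log_of_pos hpos
    rw [← hratio, ← hL, hratio] at this
    refine le_trans ?_ this
    have h1 : 1 - (1 + (m : ℝ) / n)⁻¹ = m / (n + m) := by
      field_simp
      ring
    rw [h1]
    gcongr
    linarith
  have hL0 : 0 < L := lt_of_lt_of_le (by positivity) hLge
  have hC0 : 0 < C := lt_of_lt_of_le (by positivity) hC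
  refine (measure_mono ?_).trans ((trainLaw_exists_interpolant_le h ha hσ hm hmn rfl).trans
    (ENNReal.ofReal_le_ofReal (Real.exp_le_exp.2 (neg_le_neg hLle))))
  rintro z ⟨S, α, hout, hlt⟩
  refine ⟨α, hlt.le.trans ?_, hout.apply_eq⟩
  calc σ ^ 2 * (1 - δ) / (C * L) ≤ σ ^ 2 * 1 / (2 * Real.exp 4 * (m / (2 * n))) := by
        gcongr
        linarith
    _ = σ ^ 2 * n / (Real.exp 4 * m) := by
        field_simp

/-- The lower bound on the test error when there are at least twice as many features as samples. -/
theorem trainLaw_testMSE_lt_le_of_two_mul_le [IsProbabilityMeasure ν] (ha : Measurable a) {c : ℝ}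
    (hc : 0 < c)
    (hexp : ∀ v : E d, ‖v‖ ≤ 1 →
      ∫⁻ x, ENNReal.ofReal (Real.exp (c * inner ℝ (a x) v ^ 2)) ∂ν ≤ 2)
    (hn : 0 < n) (hnd : 2 * n ≤ d) {C σ δ : ℝ} (hC : 28 * Real.exp 2 / c ≤ C) (hσ : 0 < σ)
    (hδ : 0 < δ) (hδ1 : δ < 1) :
    trainLaw n ν σ {z | ∃ (S : Finset (Fin d)) (α : E d),
        IsOMPOutput (trainMatrix a z.1) (trainOutput a 0 z.1 z.2) S α ∧
          ‖α‖ ^ 2 < σ ^ 2 * (1 - δ) / (C * Real.log ((d : ℝ) / n))} ≤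
      ENNReal.ofReal (Real.exp (-(n * Real.log ((d : ℝ) / n)))) +
        ENNReal.ofReal (Real.exp (-(n * δ ^ 2 / 2))) := by
  have hn' : (0 : ℝ) < n := by exact_mod_cast hn
  have hnd' : 2 * (n : ℝ) ≤ d := by exact_mod_cast hnd
  set L := Real.log ((d : ℝ) / n) with hL
  have hL0 : 0 < L := Real.log_pos (by rw [lt_div_iff₀ hn']; linarith)
  have hC0 : 0 < C := lt_of_lt_of_le (by positivity) hC
  set X : Set (Fin n → E p) := {x | ∃ v : E d, (support v).card = n ∧
    28 * n * L / c * ‖v‖ ^ 2 < ‖apply (trainMatrix a x) v‖ ^ 2} with hX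
  set Wn : Set (Fin n → ℝ) :=
    {w | ‖(WithLp.toLp 2 w : E n)‖ ^ 2 ≤ Real.exp (-2) * σ ^ 2 * n} with hWn
  set N : Set ((Fin n → E p) × (Fin n → ℝ)) := {z | ¬ ∀ (S : Finset (Fin d)) (α : E d),
    IsOMPOutput (trainMatrix a z.1) (trainOutput a 0 z.1 z.2) S α →
      S.card = n ∧ (support α).card = n} with hN
  have hN0 : trainLaw n ν σ N = 0 := ae_isOMPOutput_card_eq ha hσ 0
  have hXle : trainLaw n ν σ (X ×ˢ Set.univ) ≤ ENNReal.ofReal (Real.exp (-(n * L))) := by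
    rw [trainLaw, Measure.prod_prod, measure_univ, mul_one]
    exact pi_exists_sparse_lt_norm_sq_apply_le ha hc hexp hn hnd
  -- A constant-factor bound on the noise energy fails with probability at most `exp (-n/2)`,
  -- already below the target because `δ < 1`.
  have hWle : trainLaw n ν σ (Set.univ ×ˢ Wn) ≤ ENNReal.ofReal (Real.exp (-(n * δ ^ 2 / 2))) := by
    rw [trainLaw, Measure.prod_prod, measure_univ, one_mul]
    refine (pi_noiseLaw_norm_sq_le hσ hn).trans (ENNReal.ofReal_le_ofReal (Real.exp_le_exp.2 ?_))
    have : δ ^ 2 ≤ 1 := pow_le_one₀ hδ.le hδ1.le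
    nlinarith
  have hsub : {z | ∃ (S : Finset (Fin d)) (α : E d),
      IsOMPOutput (trainMatrix a z.1) (trainOutput a 0 z.1 z.2) S α ∧
        ‖α‖ ^ 2 < σ ^ 2 * (1 - δ) / (C * L)} ⊆ N ∪ (X ×ˢ Set.univ ∪ Set.univ ×ˢ Wn) := by
    rintro z ⟨S, α, hout, hlt⟩
    by_cases hzN : z ∈ N
    · exact Or.inl hzN
    refine Or.inr ?_
    have hcard := (not_not.1 hzN S α hout).2
    by_cases hzX : z.1 ∈ X
    · exact Or.inl ⟨hzX, Set.mem_univ _⟩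
    refine Or.inr ⟨Set.mem_univ _, ?_⟩
    have happ := hout.apply_eq
    rw [trainOutput_zero] at happ
    have hop : ‖apply (trainMatrix a z.1) α‖ ^ 2 ≤ 28 * n * L / c * ‖α‖ ^ 2 :=
      not_lt.1 fun hlt' => hzX ⟨α, hcard, hlt'⟩
    rw [happ] at hop
    refine hop.trans ?_
    have hnum : 28 * n * L / c * (σ ^ 2 * (1 - δ) / (C * L)) =
        28 / (c * C) * (σ ^ 2 * n * (1 - δ)) := by
      field_simp
    -- The lower bound on `C` is chosen so that a small `α` would place the noise in `Wn`.
    have hcC : 28 / (c * C) ≤ Real.exp (-2) := by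
      rw [div_le_iff₀ hc] at hC
      rw [div_le_iff₀ (by positivity), Real.exp_neg, ← div_eq_inv_mul,
        le_div_iff₀ (Real.exp_pos _)]
      linarith
    calc 28 * n * L / c * ‖α‖ ^ 2 ≤ 28 * n * L / c * (σ ^ 2 * (1 - δ) / (C * L)) := by gcongr
      _ = 28 / (c * C) * (σ ^ 2 * n * (1 - δ)) := hnum
      _ ≤ Real.exp (-2) * (σ ^ 2 * n * 1) := by
          gcongr
          linarith
      _ = _ := by ring
  refine (measure_mono hsub).trans ((measure_union_le _ _).trans ?_)
  rw [hN0, zero_add]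
  exact (measure_union_le _ _).trans (add_le_add hXle hWle)

end Model

end OMP

/-! ### The two regimes combined. -/

theorem corollary3 :
    -- For every full-rank design matrix: each iteration of OMP selects a new feature, at most `n`
    -- are selected, OMP runs to completion on every output, and it is 1-parsimonious.
    (∀ (n d : ℕ) (A : Matrix (Fin n) (Fin d) ℝ), A.rank = n →
      (∀ (y : OMP.E n) (t : ℕ) (S : Finset (Fin d)),
        OMP.OMPReaches A y t S → S.card = t ∧ t ≤ n) ∧
      (∀ y : OMP.E n, ∃ (S : Finset (Fin d)) (α : OMP.E d), OMP.IsOMPOutput A y S α) ∧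
      (∀ f : OMP.E n → OMP.E d,
        (∀ y, ∃ S : Finset (Fin d), OMP.IsOMPOutput A y S (f y)) → OMP.IsParsimonious A 1 f)) ∧
    -- The constant `C` depends on the sub-Gaussian parameter only.
    (∀ K : ℝ, 0 < K → ∃ C : ℝ, 0 < C ∧
      ∀ (n d p : ℕ) (ν : MeasureTheory.Measure (OMP.E p)) (a : OMP.E p → OMP.E d),
        0 < n → n < d → MeasureTheory.IsProbabilityMeasure ν → Measurable a →
        OMP.IsWhitened ν a →
        (OMP.IsGaussianFeature ν a ∨ OMP.IsSubGaussianFeature ν K a) →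
        -- Almost surely, OMP run to completion selects and uses exactly `n` features.
        (∀ σ : ℝ, 0 < σ → ∀ αstar : OMP.E d,
          ∀ᵐ z ∂(OMP.trainLaw n ν σ), ∀ (S : Finset (Fin d)) (α : OMP.E d),
            OMP.IsOMPOutput (OMP.trainMatrix a z.1) (OMP.trainOutput a αstar z.1 z.2) S α →
              S.card = n ∧ (OMP.support α).card = n) ∧
        -- On some instance of the sparse model, the test MSE is large with high probability.
        (∀ (k : ℕ) (σ : ℝ), 0 < σ → ∃ αstar : OMP.E d, (OMP.support αstar).card ≤ k ∧
          ∀ δ : ℝ, 0 < δ →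
            OMP.trainLaw n ν σ {z | ¬ ∀ (S : Finset (Fin d)) (α : OMP.E d),
              OMP.IsOMPOutput (OMP.trainMatrix a z.1) (OMP.trainOutput a αstar z.1 z.2) S α →
                σ ^ 2 * (1 - δ) / (C * Real.log ((d : ℝ) / n)) ≤ OMP.testMSE ν σ a αstar α} ≤
            ENNReal.ofReal (Real.exp (-(n * Real.log ((d : ℝ) / n))) +
              Real.exp (-(n * δ ^ 2 / 2))))) := by
  refine ⟨fun n d A hA => ⟨fun y t S hS => hS.card_le hA, OMP.exists_isOMPOutput hA,
    fun f hf => OMP.isParsimonious_of_isOMPOutput hA hf⟩, fun K hK => ?_⟩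
  obtain ⟨c, hc, hexp⟩ := OMP.exists_lintegral_exp_inner_sq_le hK
  -- The sum dominates the constants of both regimes.
  refine ⟨2 * Real.exp 4 + 28 * Real.exp 2 / c, by positivity, ?_⟩
  intro n d p ν a hn hnd _ ha hw hfeat
  -- The zero signal is admissible for every `k`, including `k = 0`.
  refine ⟨fun σ hσ αstar => OMP.ae_isOMPOutput_card_eq ha hσ αstar, fun k σ hσ =>
    ⟨0, by simp [OMP.support], fun δ hδ => ?_⟩⟩
  simp only [OMP.testMSE_zero hw ha, not_forall, not_le, exists_prop]
  have hL0 : 0 < Real.log ((d : ℝ) / n) := by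
    have hn' : (0 : ℝ) < n := by exact_mod_cast hn
    exact Real.log_pos (by rw [lt_div_iff₀ hn', one_mul]; exact_mod_cast hnd)
  rw [ENNReal.ofReal_add (Real.exp_pos _).le (Real.exp_pos _).le]
  -- For `δ ≥ 1` the threshold is nonpositive and the bad event is empty.
  rcases le_or_gt 1 δ with hδ1 | hδ1
  · refine (measure_mono_null ?_ measure_empty).trans_le zero_le
    rintro z ⟨S, α, -, hlt⟩
    have : σ ^ 2 * (1 - δ) / ((2 * Real.exp 4 + 28 * Real.exp 2 / c) *
        Real.log ((d : ℝ) / n)) ≤ 0 :=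
      div_nonpos_of_nonpos_of_nonneg
        (mul_nonpos_of_nonneg_of_nonpos (sq_nonneg σ) (by linarith)) (by positivity)
    exact absurd (hlt.trans_le this) (not_lt.2 (sq_nonneg _))
  rcases le_total d (2 * n) with hd | hd
  · exact (OMP.trainLaw_testMSE_lt_le_of_le_two_mul hw ha hn hnd hd
      (le_add_of_nonneg_right (by positivity)) hσ hδ).trans le_self_add
  · exact OMP.trainLaw_testMSE_lt_le_of_two_mul_le ha hc (hexp d p ν a inferInstance ha hw hfeat)
      hn hd (le_add_of_nonneg_left (by positivity)) hσ hδ hδ1
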